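/- **Notation.** Let $d\ge 1$, $B_\rho(x)=\{y\in\mathbb R^d:|x-y|<\rho\}$, $B_\rho=B_\rho(0)$, and $J_p(\xi)=|\xi|^{p-2}\xi$. For an open set $\Omega\subset\mathbb R^d$, $\phi\in C^4_b(\Omega)$ means that $\phi\in C^4(\Omega)$ and that all partial derivatives of $\phi$ of order $0,\dots,4$ are bounded on $\Omega$. Put $$\Delta_p\phi(x)=\nabla\cdot\left(|\nabla\phi|^{p-2}\nabla\phi\right)(x),\qquad -(-\Delta)^s_p\phi(x)=\lim_{\varepsilon\to0^+}\int_{\mathbb R^d\setminus B_\varepsilon}J_p(\phi(x+y)-\phi(x))\,\frac{dy}{|y|^{d+sp}}$$ (no normalizing constant), and, with $\kappa_{p,d}=2\left(\frac1{\sigma(\partial B_1)}\int_{\partial B_1}|y_1|^p\,d\sigma(y)\right)^{-1}$, where $\sigma$ is the surface measure (counting measure if $d=1$), $$\mathcal M^p_{r,1}[\phi](x)=\frac{\kappa_{p,d}}{r^p}\frac1{\sigma(\partial B_r)}\int_{\partial B_r}J_p(\phi(x+y)-\phi(x))\,d\sigma(y),\qquad \mathcal M^p_{r,2}[\phi](x)=\frac{(p+d)\kappa_{p,d}}{d\,r^p}\frac1{|B_r|}\int_{B_r}J_p(\phi(x+y)-\phi(x))\,dy,$$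 $$\mathcal M^{s,p}_r[\phi](x)=\frac{p+d}{p(1-s)r^{d+sp}}\int_{B_r}J_p(\phi(x+y)-\phi(x))\,dy+\int_{\mathbb R^d\setminus B_r}J_p(\phi(x+y)-\phi(x))\,\frac{dy}{|y|^{d+sp}}.$$ **Theorem 2.1.** Let $p\ge2$, $s\in(0,1)$, $x\in\mathbb R^d$, $0<R<1$, and let $\phi:\mathbb R^d\to\mathbb R$ satisfy $\phi\in C^4_b(B_R(x))$. Put $\gamma=2$ if $p=2$ or $p\ge4$, and $\gamma=p-2$ if $p\in(2,4)$. 1. There is a constant $C>0$ such that for all $z\in B_{R/2}(x)$ the vector field $|\nabla\phi|^{p-2}\nabla\phi$ is differentiable at $z$, and for all $0<r<R/2$ and $i\in\{1,2\}$ $$\left|\Delta_p\phi(z)-\mathcal M^p_{r,i}[\phi](z)\right|\le C\,r^{\gamma}.$$ 2. If in addition $\phi\in L^\infty(\mathbb R^d)$, then there is a constant $C>0$ such that for all $z\in B_{R/2}(x)$ the principal value $-(-\Delta)^s_p\phi(z)$ exists, the integrals over $\mathbb R^d\setminus B_\varepsilon$ in its definition converging absolutely for every $\varepsilon>0$, and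 for all $0<r<R/2$ $$\left|-(-\Delta)^s_p\phi(z)-\mathcal M^{s,p}_r[\phi](z)\right|\le C\,r^{\gamma+p(1-s)}.$$ -/

import Mathlib

open MeasureTheory Set Filter Topology Metric

noncomputable section

namespace PLap

/-- `J_p(ξ) = |ξ|^(p-2) ξ`. For `p = 2` this is `ξ`, since `0 ^ 0 = 1` for real powers. -/
def J (p ξ : ℝ) : ℝ := |ξ| ^ (p - 2) * ξ

/-- `φ ∈ C^k_b(Ω)` for an open set `Ω`: `φ` is `C^k` on `Ω`, and all its derivatives
of order `0, ..., k` are bounded on `Ω`. -/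
def MemCb {d : ℕ} (k : ℕ) (φ : EuclideanSpace ℝ (Fin d) → ℝ)
    (Ω : Set (EuclideanSpace ℝ (Fin d))) : Prop :=
  ContDiffOn ℝ k φ Ω ∧ ∀ j ≤ k, ∃ K : ℝ, ∀ y ∈ Ω, ‖iteratedFDeriv ℝ j φ y‖ ≤ K

/-- The vector field `|∇φ|^(p-2) ∇φ`. -/
def flux {d : ℕ} (p : ℝ) (φ : EuclideanSpace ℝ (Fin d) → ℝ)
    (x : EuclideanSpace ℝ (Fin d)) : EuclideanSpace ℝ (Fin d) :=
  ‖gradient φ x‖ ^ (p - 2) • gradient φ x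

/-- The divergence `∑ i, ∂_i F_i`. -/
def divergence {d : ℕ} (F : EuclideanSpace ℝ (Fin d) → EuclideanSpace ℝ (Fin d))
    (x : EuclideanSpace ℝ (Fin d)) : ℝ :=
  ∑ i : Fin d, (fderiv ℝ F x (EuclideanSpace.single i 1)) i

/-- The `p`-Laplacian `Δ_p φ = ∇ · (|∇φ|^(p-2) ∇φ)`. -/
def pLaplacian {d : ℕ} (p : ℝ) (φ : EuclideanSpace ℝ (Fin d) → ℝ)
    (x : EuclideanSpace ℝ (Fin d)) : ℝ :=
  divergence (flux p φ) x

/-- The mean of `f` over the sphere `∂B_r` centred at the origin with respect to surface measure: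
the mean over the unit sphere, with its surface measure `volume.toSphere`, of `ω ↦ f (r ω)`. -/
def sphereAverage {d : ℕ} (r : ℝ) (f : EuclideanSpace ℝ (Fin d) → ℝ) : ℝ :=
  ⨍ ω : sphere (0 : EuclideanSpace ℝ (Fin d)) 1, f (r • (ω : EuclideanSpace ℝ (Fin d)))
    ∂(volume : Measure (EuclideanSpace ℝ (Fin d))).toSphere

/-- `κ_{p,d} = 2 (⨍_{∂B_1} |y_1|^p dσ(y))⁻¹`; the index `0` is the first coordinate. -/
def kappa (p : ℝ) (d : ℕ) [NeZero d] : ℝ :=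
  2 * (sphereAverage 1 fun y : EuclideanSpace ℝ (Fin d) => |y 0| ^ p)⁻¹

/-- The expansion by spherical means,
`κ_{p,d} / r^p * ⨍_{∂B_r} J_p(φ(x+y) - φ(x)) dσ(y)`. -/
def M₁ {d : ℕ} [NeZero d] (p r : ℝ) (φ : EuclideanSpace ℝ (Fin d) → ℝ)
    (x : EuclideanSpace ℝ (Fin d)) : ℝ :=
  kappa p d / r ^ p * sphereAverage r fun y => J p (φ (x + y) - φ x)

/-- The expansion by solid means,
`(p+d) κ_{p,d} / (d r^p) * ⨍_{B_r} J_p(φ(x+y) - φ(x)) dy`. -/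
def M₂ {d : ℕ} [NeZero d] (p r : ℝ) (φ : EuclideanSpace ℝ (Fin d) → ℝ)
    (x : EuclideanSpace ℝ (Fin d)) : ℝ :=
  (p + d) * kappa p d / (d * r ^ p) * ⨍ y in ball 0 r, J p (φ (x + y) - φ x)

/-- The integrand `J_p(φ(x+y) - φ(x)) / |y|^(d+sp)` of the fractional `p`-Laplacian. -/
def fracIntegrand {d : ℕ} (s p : ℝ) (φ : EuclideanSpace ℝ (Fin d) → ℝ)
    (x y : EuclideanSpace ℝ (Fin d)) : ℝ :=
  J p (φ (x + y) - φ x) / ‖y‖ ^ ((d : ℝ) + s * p)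

/-- `-(-Δ)^s_p φ(x)` exists as a principal value (without normalizing constant) and equals `L`:
the integrals over the complements of the balls `B_ε` converge absolutely, and
they tend to `L` as `ε → 0⁺`. -/
def HasFracPLaplacian {d : ℕ} (s p : ℝ) (φ : EuclideanSpace ℝ (Fin d) → ℝ)
    (x : EuclideanSpace ℝ (Fin d)) (L : ℝ) : Prop :=
  (∀ ε : ℝ, 0 < ε → IntegrableOn (fracIntegrand s p φ x) (ball 0 ε)ᶜ) ∧
    Tendsto (fun ε : ℝ => ∫ y in (ball 0 ε)ᶜ, fracIntegrand s p φ x y) (𝓝[>] 0) (𝓝 L)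

/-- The expansion of the fractional `p`-Laplacian,
`(p+d) / (p (1-s) r^(d+sp)) * ∫_{B_r} J_p(φ(x+y) - φ(x)) dy
  + ∫_{ℝ^d ∖ B_r} J_p(φ(x+y) - φ(x)) / |y|^(d+sp) dy`. -/
def Mfrac {d : ℕ} (s p r : ℝ) (φ : EuclideanSpace ℝ (Fin d) → ℝ)
    (x : EuclideanSpace ℝ (Fin d)) : ℝ :=
  (p + d) / (p * (1 - s) * r ^ ((d : ℝ) + s * p)) * (∫ y in ball 0 r, J p (φ (x + y) - φ x))
    + ∫ y in (ball 0 r)ᶜ, fracIntegrand s p φ x y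

open Classical in
/-- The order `γ`: it is `2` if `p = 2` or `p ≥ 4`, and `p - 2` if `2 < p < 4`. -/
def gammaExp (p : ℝ) : ℝ := if p = 2 ∨ 4 ≤ p then 2 else p - 2

end PLap

end

noncomputable section

namespace PLap

/-! Spheres, balls and the weight |y|^(-d-sp) are invariant under y ↦ -y, so only the even part of y
↦ J_p(φ(z+y) - φ(z)) matters. Let u, v be the increments of φ at y and -y, A = (u-v)/2 and B =
(u+v)/2. By Taylor, A = ∇φ·y + O(|y|^3) and B = D²φ(y,y)/2 + O(|y|^4), while J(u) + J(v) = J(A+B) -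
J(A-B) ≈ 2J'(A)B. Hence the symmetrized increment is Q(y) = (p-1)|∇φ·y|^(p-2) D²φ(y,y) up to
O(|y|^(p+γ)), uniformly in z (`exists_abs_J_add_J_sub_leadingTerm_le`). The order γ is limited by
directions in which ∇φ·y is not large compared with |y|^2: there the only bound is |B|^(p-1) =
O(|y|^(2p-2)), which costs accuracy when 2 < p < 4. For p = 2 the map J is linear and nothing is
lost.

Since Q is p-homogeneous, its integrals over spheres and balls, weighted by powers of |y|, are
explicit powers of r times N, the integral of Q over the unit sphere
(`setIntegral_ball_homogeneous`). On the other side, |a|^(p-2) a is a multiple of the spherical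
integral of J_p(a·ω) ω, by reflection symmetry (`integral_sphere_J_inner_smul`). Differentiating
under that integral shows that the flux is differentiable, also at critical points of φ, and that
Δ_p φ is N divided by the integral of |y_1|^p over the unit sphere (`pLaplacian_eq`).

For the fractional operator the tails outside B_r cancel exactly. Inside, the principal value and
the solid integral both have main term a multiple of N, and the factor (p+d)/(p(1-s) r^(d+sp)) is
the one that makes these agree. -/

theorem integral_Ioo_rpow {r m : ℝ} (hr : 0 < r) (hm : -1 < m) :
    ∫ ρ in Ioo (0 : ℝ) r, ρ ^ m = r ^ (m + 1) / (m + 1) := by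
  rw [← integral_Ioc_eq_integral_Ioo, ← intervalIntegral.integral_of_le hr.le,
    integral_rpow (Or.inl hm), Real.zero_rpow (by linarith), sub_zero]

theorem pow_pred_mul_rpow {ρ : ℝ} (hρ : 0 < ρ) {n : ℕ} (hn : 0 < n) (m : ℝ) :
    ρ ^ (n - 1) * ρ ^ m = ρ ^ (m + n - 1) := by
  rw [← Real.rpow_natCast, ← Real.rpow_add hρ, Nat.cast_pred hn]
  congr 1
  ring

theorem integral_Ioi_indicator_rpow {r m : ℝ} {n : ℕ} (hn : 0 < n) (hr : 0 < r)
    (hm : 0 < m + n) :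
    ∫ ρ in Ioi (0 : ℝ), ρ ^ (n - 1) * (Iio r).indicator (fun ρ => ρ ^ m) ρ =
      r ^ (m + n) / (m + n) := by
  have h₁ : ∀ ρ ∈ Ioi (0 : ℝ),
      ρ ^ (n - 1) * (Iio r).indicator (fun ρ => ρ ^ m) ρ =
        (Iio r).indicator (fun ρ => ρ ^ (m + n - 1)) ρ := by
    intro ρ hρ
    by_cases h : ρ ∈ Iio r
    · simp only [indicator_of_mem h]
      exact pow_pred_mul_rpow hρ hn m
    · simp [indicator_of_notMem h]
  rw [setIntegral_congr_fun measurableSet_Ioi h₁, setIntegral_indicator measurableSet_Iio,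
    Ioi_inter_Iio, integral_Ioo_rpow hr (by linarith), sub_add_cancel]

/-! ### Polar coordinates and integrals of homogeneous functions -/

section Polar

variable {E : Type*} [NormedAddCommGroup E] [InnerProductSpace ℝ E] [FiniteDimensional ℝ E]
  [MeasurableSpace E] [BorelSpace E] [Nontrivial E]

/-- Integration in polar coordinates of a product of a radial and an angular function. -/
theorem integral_radial_mul_angular (h : ℝ → ℝ) (q : E → ℝ) :
    ∫ y : E, h ‖y‖ * q (‖y‖⁻¹ • y) =
      (∫ ρ in Ioi (0 : ℝ), ρ ^ (Module.finrank ℝ E - 1) * h ρ) *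
        ∫ ω : sphere (0 : E) 1, q ω ∂(volume : Measure E).toSphere := by
  calc
    ∫ y : E, h ‖y‖ * q (‖y‖⁻¹ • y)
      = ∫ y : ({(0)}ᶜ : Set E), h ‖y.1‖ * q (‖y.1‖⁻¹ • y.1) ∂((volume : Measure E).comap Subtype.val) := by
      rw [integral_subtype_comap (measurableSet_singleton _).compl
        fun y ↦ h ‖y‖ * q (‖y‖⁻¹ • y), restrict_compl_singleton]
    _ = ∫ x : sphere (0 : E) 1 × Ioi (0 : ℝ), q x.1 * h x.2
          ∂(volume : Measure E).toSphere.prod (.volumeIoiPow (Module.finrank ℝ E - 1)) := by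
      rw [← (volume : Measure E).measurePreserving_homeomorphUnitSphereProd.integral_comp
        (Homeomorph.measurableEmbedding _)]
      simp [mul_comm]
    _ = (∫ ω : sphere (0 : E) 1, q ω ∂(volume : Measure E).toSphere) *
          ∫ x : Ioi (0 : ℝ), h x ∂.volumeIoiPow (Module.finrank ℝ E - 1) :=
      integral_prod_mul (fun ω : sphere (0 : E) 1 => q ω) fun x : Ioi (0 : ℝ) => h x
    _ = _ := by
      rw [mul_comm]
      congr 1
      simp only [Measure.volumeIoiPow, ENNReal.ofReal]
      rw [integral_withDensity_eq_integral_smul,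
        integral_subtype_comap measurableSet_Ioi
          fun a ↦ Real.toNNReal (a ^ (Module.finrank ℝ E - 1)) • h a,
        setIntegral_congr_fun measurableSet_Ioi fun x hx ↦ ?_]
      · rw [NNReal.smul_def, Real.coe_toNNReal _ (pow_nonneg hx.out.le _), smul_eq_mul]
      · exact (measurable_subtype_coe.pow_const _).real_toNNReal

/-- The surface measure of the unit sphere is invariant under linear isometries. -/
theorem integral_sphere_comp_isometry (T : E ≃ₗᵢ[ℝ] E) (q : E → ℝ) :
    ∫ ω : sphere (0 : E) 1, q (T ω) ∂(volume : Measure E).toSphere =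
      ∫ ω : sphere (0 : E) 1, q ω ∂(volume : Measure E).toSphere := by
  set h : ℝ → ℝ := (Iio 1).indicator fun ρ => ρ ^ (0 : ℝ)
  -- The cutoff to the unit ball has radial integral 1 / dim E, which is nonzero, so it can be
  -- cancelled once Lebesgue invariance is applied to both polar formulas.
  have hpos : (0 : ℝ) < 0 + Module.finrank ℝ E := by
    rw [zero_add]; exact_mod_cast Module.finrank_pos
  have hh := integral_Ioi_indicator_rpow Module.finrank_pos one_pos hpos
  have h₁ := integral_radial_mul_angular h q
  have h₂ := integral_radial_mul_angular h fun y => q (T y)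
  have h₃ : ∫ y : E, h ‖y‖ * q (T (‖y‖⁻¹ • y)) = ∫ y : E, h ‖y‖ * q (‖y‖⁻¹ • y) := by
    simpa using T.measurePreserving.integral_comp T.toHomeomorph.measurableEmbedding
      fun y => h ‖y‖ * q (‖y‖⁻¹ • y)
  rw [h₂, h₁, hh] at h₃
  refine mul_left_cancel₀ ?_ h₃
  rw [Real.one_rpow]
  exact (one_div_pos.2 hpos).ne'

theorem integral_sphere_comp_neg (q : E → ℝ) :
    ∫ ω : sphere (0 : E) 1, q (-ω) ∂(volume : Measure E).toSphere =
      ∫ ω : sphere (0 : E) 1, q ω ∂(volume : Measure E).toSphere := by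
  simpa using integral_sphere_comp_isometry (LinearIsometryEquiv.neg ℝ) q

/-- The integral over a ball of a homogeneous function times a power of the norm. -/
theorem setIntegral_ball_homogeneous {p k r : ℝ} (hr : 0 < r)
    (hk : 0 < p + k + Module.finrank ℝ E) (Q : E → ℝ)
    (hQ : ∀ t : ℝ, 0 < t → ∀ y, Q (t • y) = t ^ p * Q y) :
    ∫ y in ball (0 : E) r, Q y * ‖y‖ ^ k =
      r ^ (p + k + Module.finrank ℝ E) / (p + k + Module.finrank ℝ E) *
        ∫ ω : sphere (0 : E) 1, Q ω ∂(volume : Measure E).toSphere := by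
  rw [← integral_Ioi_indicator_rpow Module.finrank_pos hr hk, ← integral_radial_mul_angular,
    ← integral_indicator measurableSet_ball]
  refine integral_congr_ae ?_
  -- The origin is discarded because Q(y) = ‖y‖^p Q(y/‖y‖) needs y ≠ 0.
  filter_upwards [(measure_eq_zero_iff_ae_notMem.1 (measure_singleton (0 : E)))] with y hy
  have hy : 0 < ‖y‖ := norm_pos_iff.2 hy
  by_cases h : ‖y‖ < r
  · rw [indicator_of_mem (by simpa using h), indicator_of_mem (by simpa using h),
      hQ _ (inv_pos.2 hy), Real.inv_rpow hy.le, Real.rpow_add hy]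
    field_simp
  · rw [indicator_of_notMem (by simpa using h), indicator_of_notMem (by simpa using h), zero_mul]

theorem integrableOn_ball_norm_rpow {m : ℝ} (r : ℝ) (hm : 0 < m + Module.finrank ℝ E) :
    IntegrableOn (fun y : E => ‖y‖ ^ m) (ball 0 r) := by
  rw [integrableOn_fun_norm_addHaar volume (f := fun ρ => ρ ^ m)]
  have h : IntegrableOn (fun ρ : ℝ => ρ ^ (m + Module.finrank ℝ E - 1)) (Ioo 0 r) := by
    rcases le_or_gt r 0 with hr | hr
    · simp [Ioo_eq_empty (not_lt.2 hr)]
    · exact ((intervalIntegral.intervalIntegrable_rpow' (by linarith) (a := 0) (b := r)).1).mono_set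
        Ioo_subset_Ioc_self
  exact h.congr_fun (fun ρ hρ => (pow_pred_mul_rpow hρ.1 Module.finrank_pos m).symm) measurableSet_Ioo

theorem setIntegral_ball_norm_rpow {m r : ℝ} (hr : 0 < r) (hm : 0 < m + Module.finrank ℝ E) :
    ∫ y in ball (0 : E) r, ‖y‖ ^ m =
      r ^ (m + Module.finrank ℝ E) / (m + Module.finrank ℝ E) *
        (volume : Measure E).toSphere.real univ := by
  have := setIntegral_ball_homogeneous (E := E) (p := 0) (k := m) hr (by simpa using hm)
    (fun _ => 1) (by simp)
  simpa using this

end Polar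

/-! ### The function J and one-variable Taylor estimates -/

section Scalar

theorem J_neg (p ξ : ℝ) : J p (-ξ) = -J p ξ := by simp [J]

theorem J_mul (p a b : ℝ) : J p (a * b) = J p a * J p b := by
  simp only [J, abs_mul, Real.mul_rpow (abs_nonneg a) (abs_nonneg b)]
  ring

theorem J_two (ξ : ℝ) : J 2 ξ = ξ := by simp [J]

theorem abs_rpow_sub_two_mul_abs {p : ℝ} (hp : 2 ≤ p) (ξ : ℝ) :
    |ξ| ^ (p - 2) * |ξ| = |ξ| ^ (p - 1) := by
  rcases eq_or_ne ξ 0 with rfl | h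
  · rw [abs_zero, mul_zero, Real.zero_rpow (by linarith)]
  · rw [← Real.rpow_add_one (abs_pos.2 h).ne']
    congr 1
    ring

theorem abs_J {p : ℝ} (hp : 2 ≤ p) (ξ : ℝ) : |J p ξ| = |ξ| ^ (p - 1) := by
  rw [J, abs_mul, abs_of_nonneg (Real.rpow_nonneg (abs_nonneg ξ) _), abs_rpow_sub_two_mul_abs hp]

theorem J_mul_self {p : ℝ} (hp : 2 ≤ p) (ξ : ℝ) : J p ξ * ξ = |ξ| ^ p := by
  rw [J, mul_assoc, ← abs_mul_abs_self, ← mul_assoc, abs_rpow_sub_two_mul_abs hp]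
  rcases eq_or_ne ξ 0 with rfl | h
  · rw [abs_zero, mul_zero, Real.zero_rpow (by linarith)]
  · rw [← Real.rpow_add_one (abs_pos.2 h).ne', sub_add_cancel]

theorem J_of_nonneg {p ξ : ℝ} (hp : 2 ≤ p) (hξ : 0 ≤ ξ) : J p ξ = ξ ^ (p - 1) := by
  have h := abs_rpow_sub_two_mul_abs hp ξ
  rw [abs_of_nonneg hξ] at h
  rw [J, abs_of_nonneg hξ, h]

theorem hasDerivAt_J {p : ℝ} (hp : 2 ≤ p) (ξ : ℝ) :
    HasDerivAt (J p) ((p - 1) * |ξ| ^ (p - 2)) ξ := by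
  have hpos : ∀ η : ℝ, 0 < η → HasDerivAt (J p) ((p - 1) * |η| ^ (p - 2)) η := by
    intro η hη
    have h := Real.hasDerivAt_rpow_const (x := η) (p := p - 1) (Or.inl hη.ne')
    rw [abs_of_pos hη]
    refine (h.congr_of_eventuallyEq ?_).congr_deriv (by congr 2; ring)
    filter_upwards [lt_mem_nhds hη] with y hy using J_of_nonneg hp hy.le
  rcases lt_trichotomy ξ 0 with h | rfl | h
  · have h₁ := (hpos (-ξ) (by linarith)).comp ξ (hasDerivAt_neg ξ)
    have h₂ : J p = fun y => -(J p ∘ Neg.neg) y := by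
      funext y; simp [J_neg]
    rw [h₂]
    exact h₁.fun_neg.congr_deriv (by simp)
  · rcases hp.eq_or_lt with rfl | hp
    -- At the origin p = 2 is separate: the convention 0 ^ 0 = 1 makes the derivative 1, while for p
    -- > 2 the slope |y|^(p-2) tends to 0.
    · have : J 2 = id := funext J_two
      rw [this]
      exact (hasDerivAt_id (0 : ℝ)).congr_deriv (by norm_num)
    · rw [abs_zero, Real.zero_rpow (by linarith), mul_zero, hasDerivAt_iff_tendsto_slope]
      have h₁ : Tendsto (fun y : ℝ => |y| ^ (p - 2)) (𝓝[≠] 0) (𝓝 0) := by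
        have : Continuous fun y : ℝ => |y| ^ (p - 2) :=
          continuous_abs.rpow_const fun _ => Or.inr (by linarith)
        have h := this.tendsto 0
        rw [abs_zero, Real.zero_rpow (by linarith)] at h
        exact h.mono_left nhdsWithin_le_nhds
      refine h₁.congr' ?_
      filter_upwards [self_mem_nhdsWithin] with y hy
      have hy : y ≠ 0 := hy
      simp [slope_def_field, J, hy]
  · exact hpos ξ h

theorem continuous_J {p : ℝ} (hp : 2 ≤ p) : Continuous (J p) :=
  continuous_iff_continuousAt.2 fun ξ => (hasDerivAt_J hp ξ).continuousAt

/-- One integration step on [0, 1], by the mean value inequality. Iterating it down a chain of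
derivatives replaces Taylor's formula with remainder. -/
theorem abs_le_of_hasDerivAt {f f' : ℝ → ℝ} {K : ℝ}
    (hf : ∀ t ∈ Icc (0 : ℝ) 1, HasDerivAt f (f' t) t) (h₀ : f 0 = 0)
    (hK : ∀ t ∈ Icc (0 : ℝ) 1, |f' t| ≤ K) : ∀ t ∈ Icc (0 : ℝ) 1, |f t| ≤ K := by
  intro t ht
  have h := (convex_Icc (0 : ℝ) 1).norm_image_sub_le_of_norm_hasDerivWithin_le
    (fun u hu => (hf u hu).hasDerivWithinAt) hK (left_mem_Icc.2 zero_le_one) ht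
  have hK₀ : 0 ≤ K := (abs_nonneg _).trans (hK t ht)
  rw [h₀, sub_zero, sub_zero, Real.norm_eq_abs, Real.norm_eq_abs, abs_of_nonneg ht.1] at h
  exact h.trans (mul_le_of_le_one_right hK₀ ht.2)

theorem neg_mem_Icc_neg_one {t : ℝ} (ht : t ∈ Icc (0 : ℝ) 1) : -t ∈ Icc (-1 : ℝ) 1 :=
  ⟨by linarith [ht.2], by linarith [ht.1]⟩

theorem mem_Icc_neg_one {t : ℝ} (ht : t ∈ Icc (0 : ℝ) 1) : t ∈ Icc (-1 : ℝ) 1 :=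
  ⟨by linarith [ht.1], ht.2⟩

theorem HasDerivAt.comp_neg' {f : ℝ → ℝ} {f' t : ℝ} (h : HasDerivAt f f' (-t)) :
    HasDerivAt (fun t => f (-t)) (-f') t := by
  simpa [Function.comp_def] using h.comp t (hasDerivAt_neg t)

/-- Third order Taylor estimate for the odd part of a function. -/
theorem abs_sub_sub_le_of_hasDerivAt {g : ℕ → ℝ → ℝ} {K : ℝ}
    (hg : ∀ k < 3, ∀ t ∈ Icc (-1 : ℝ) 1, HasDerivAt (g k) (g (k + 1) t) t)
    (hK : ∀ t ∈ Icc (-1 : ℝ) 1, |g 3 t| ≤ K) :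
    |g 0 1 - g 0 (-1) - 2 * g 1 0| ≤ 2 * K := by
  -- The bound descends from the third derivative of t ↦ g(t) - g(-t) to the function itself; at
  -- each level the Taylor polynomial is subtracted, so the difference vanishes at 0.
  have h₃ : ∀ t ∈ Icc (0 : ℝ) 1, |g 3 t + g 3 (-t)| ≤ 2 * K := fun t ht =>
    (abs_add_le _ _).trans (by
      linarith [hK _ (mem_Icc_neg_one ht), hK _ (neg_mem_Icc_neg_one ht)])
  have h₂ : ∀ t ∈ Icc (0 : ℝ) 1, |g 2 t - g 2 (-t)| ≤ 2 * K := by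
    refine abs_le_of_hasDerivAt (f := fun t => g 2 t - g 2 (-t)) (fun t ht => ?_) (by simp) h₃
    exact ((hg 2 (by norm_num) t (mem_Icc_neg_one ht)).fun_sub
      (HasDerivAt.comp_neg' (hg 2 (by norm_num) (-t) (neg_mem_Icc_neg_one ht)))).congr_deriv (by ring)
  have h₁ : ∀ t ∈ Icc (0 : ℝ) 1, |g 1 t + g 1 (-t) - 2 * g 1 0| ≤ 2 * K := by
    refine abs_le_of_hasDerivAt (f := fun t => g 1 t + g 1 (-t) - 2 * g 1 0) (fun t ht => ?_)
      (by simp; ring) h₂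
    exact (((hg 1 (by norm_num) t (mem_Icc_neg_one ht)).fun_add
      (HasDerivAt.comp_neg' (hg 1 (by norm_num) (-t) (neg_mem_Icc_neg_one ht)))).sub_const
        (2 * g 1 0)).congr_deriv (by ring)
  have h₀ : ∀ t ∈ Icc (0 : ℝ) 1, |g 0 t - g 0 (-t) - 2 * g 1 0 * t| ≤ 2 * K := by
    refine abs_le_of_hasDerivAt (f := fun t => g 0 t - g 0 (-t) - 2 * g 1 0 * t) (fun t ht => ?_)
      (by simp) h₁
    exact (((hg 0 (by norm_num) t (mem_Icc_neg_one ht)).fun_sub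
      (HasDerivAt.comp_neg' (hg 0 (by norm_num) (-t) (neg_mem_Icc_neg_one ht)))).fun_sub
        ((hasDerivAt_id t).const_mul (2 * g 1 0))).congr_deriv (by ring)
  simpa using h₀ 1 (right_mem_Icc.2 zero_le_one)

/-- Fourth order Taylor estimate for the even part of a function. -/
theorem abs_add_sub_le_of_hasDerivAt {g : ℕ → ℝ → ℝ} {K : ℝ}
    (hg : ∀ k < 4, ∀ t ∈ Icc (-1 : ℝ) 1, HasDerivAt (g k) (g (k + 1) t) t)
    (hK : ∀ t ∈ Icc (-1 : ℝ) 1, |g 4 t| ≤ K) :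
    |g 0 1 + g 0 (-1) - 2 * g 0 0 - g 2 0| ≤ 2 * K := by
  have h₄ : ∀ t ∈ Icc (0 : ℝ) 1, |g 4 t + g 4 (-t)| ≤ 2 * K := fun t ht =>
    (abs_add_le _ _).trans (by
      linarith [hK _ (mem_Icc_neg_one ht), hK _ (neg_mem_Icc_neg_one ht)])
  have h₃ : ∀ t ∈ Icc (0 : ℝ) 1, |g 3 t - g 3 (-t)| ≤ 2 * K := by
    refine abs_le_of_hasDerivAt (f := fun t => g 3 t - g 3 (-t)) (fun t ht => ?_) (by simp) h₄
    exact ((hg 3 (by norm_num) t (mem_Icc_neg_one ht)).fun_sub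
      (HasDerivAt.comp_neg' (hg 3 (by norm_num) (-t) (neg_mem_Icc_neg_one ht)))).congr_deriv (by ring)
  have h₂ : ∀ t ∈ Icc (0 : ℝ) 1, |g 2 t + g 2 (-t) - 2 * g 2 0| ≤ 2 * K := by
    refine abs_le_of_hasDerivAt (f := fun t => g 2 t + g 2 (-t) - 2 * g 2 0) (fun t ht => ?_)
      (by simp; ring) h₃
    exact (((hg 2 (by norm_num) t (mem_Icc_neg_one ht)).fun_add
      (HasDerivAt.comp_neg' (hg 2 (by norm_num) (-t) (neg_mem_Icc_neg_one ht)))).sub_const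
        (2 * g 2 0)).congr_deriv (by ring)
  have h₁ : ∀ t ∈ Icc (0 : ℝ) 1, |g 1 t - g 1 (-t) - 2 * g 2 0 * t| ≤ 2 * K := by
    refine abs_le_of_hasDerivAt (f := fun t => g 1 t - g 1 (-t) - 2 * g 2 0 * t) (fun t ht => ?_)
      (by simp) h₂
    exact (((hg 1 (by norm_num) t (mem_Icc_neg_one ht)).fun_sub
      (HasDerivAt.comp_neg' (hg 1 (by norm_num) (-t) (neg_mem_Icc_neg_one ht)))).fun_sub
        ((hasDerivAt_id t).const_mul (2 * g 2 0))).congr_deriv (by ring)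
  have h₀ : ∀ t ∈ Icc (0 : ℝ) 1, |g 0 t + g 0 (-t) - 2 * g 0 0 - g 2 0 * t ^ 2| ≤ 2 * K := by
    refine abs_le_of_hasDerivAt (f := fun t => g 0 t + g 0 (-t) - 2 * g 0 0 - g 2 0 * t ^ 2)
      (fun t ht => ?_) (by simp; ring) h₁
    exact ((((hg 0 (by norm_num) t (mem_Icc_neg_one ht)).fun_add
      (HasDerivAt.comp_neg' (hg 0 (by norm_num) (-t) (neg_mem_Icc_neg_one ht)))).sub_const
        (2 * g 0 0)).fun_sub ((hasDerivAt_pow 2 t).const_mul (g 2 0))).congr_deriv (by push_cast; ring)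
  simpa using h₀ 1 (right_mem_Icc.2 zero_le_one)

theorem rpow_le_two_rpow_abs {x : ℝ} (h₁ : 1 / 2 ≤ x) (h₂ : x ≤ 2) (a : ℝ) :
    x ^ a ≤ 2 ^ |a| := by
  rcases le_or_gt 0 a with ha | ha
  · rw [abs_of_nonneg ha]
    exact Real.rpow_le_rpow (by linarith) h₂ ha
  · rw [abs_of_neg ha, Real.rpow_neg zero_le_two, ← Real.inv_rpow zero_le_two]
    exact Real.rpow_le_rpow_of_nonpos (by norm_num) (by linarith) ha.le

/-- For |t| ≤ 1/2 the arguments stay in [1/2, 2], away from the singularity of J at 0, and the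
difference is odd in t, so the quadratic term drops out. The constant is twice a bound for the third
derivative of u^(p-1). -/
theorem abs_J_one_add_sub_le {p : ℝ} (hp : 2 ≤ p) :
    ∃ C : ℝ, 0 ≤ C ∧ ∀ t : ℝ, |t| ≤ 1 / 2 →
      |J p (1 + t) - J p (1 - t) - 2 * (p - 1) * t| ≤ C * |t| ^ 3 := by
  refine ⟨2 * (|(p - 1) * (p - 2) * (p - 3)| * 2 ^ |p - 4|), by positivity, fun t ht => ?_⟩
  obtain ⟨ht₁, ht₂⟩ := abs_le.1 ht
  have hx : ∀ τ ∈ Icc (-1 : ℝ) 1, 1 / 2 ≤ 1 + t * τ ∧ 1 + t * τ ≤ 2 := by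
    intro τ hτ
    have : |t * τ| ≤ 1 / 2 := by
      rw [abs_mul]
      nlinarith [abs_le.2 hτ, abs_nonneg τ, abs_nonneg t]
    constructor <;> linarith [abs_le.1 this]
  -- Falling factorials from successive differentiation of u^(p-1); the default branch is only used
  -- for k = 3.
  let c : ℕ → ℝ := fun k =>
    match k with
    | 0 => 1
    | 1 => p - 1
    | 2 => (p - 1) * (p - 2)
    | _ => (p - 1) * (p - 2) * (p - 3)
  have hc : ∀ k < 3, c k * (p - 1 - k) = c (k + 1) := by
    intro k hk
    interval_cases k <;> simp only [c] <;> push_cast <;> ring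
  have h := abs_sub_sub_le_of_hasDerivAt (K := |(p - 1) * (p - 2) * (p - 3)| * 2 ^ |p - 4| * |t| ^ 3)
    
    (g := fun k τ => c k * t ^ k * (1 + t * τ) ^ (p - 1 - k)) (fun k hk τ hτ => ?_) fun τ hτ => ?_
  · simp only [c, pow_zero, pow_one, mul_one, mul_neg, mul_zero, add_zero, Real.one_rpow,
      Nat.cast_zero, sub_zero, one_mul, Nat.cast_one] at h
    rw [J_of_nonneg hp (by linarith), J_of_nonneg hp (by linarith), sub_eq_add_neg 1 t]
    simpa only [mul_assoc] using h
  · have h₁ : HasDerivAt (fun τ => 1 + t * τ) t τ := by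
      simpa using ((hasDerivAt_id τ).const_mul t).const_add 1
    refine ((h₁.rpow_const (p := p - 1 - k)
      (Or.inl (by linarith [(hx τ hτ).1]))).const_mul (c k * t ^ k)).congr_deriv ?_
    rw [← hc k hk]
    push_cast
    rw [show p - 1 - k - 1 = p - 1 - (k + 1) by ring]
    ring
  · have h₁ := rpow_le_two_rpow_abs (hx τ hτ).1 (hx τ hτ).2 (p - 4)
    have h₂ : (0 : ℝ) ≤ (1 + t * τ) ^ (p - 4) := Real.rpow_nonneg (by linarith [(hx τ hτ).1]) _
    have h₃ : p - 1 - (3 : ℕ) = p - 4 := by push_cast; ring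
    simp only [c]
    rw [h₃, abs_mul, abs_mul _ (t ^ 3), abs_pow, abs_of_nonneg h₂]
    nlinarith [mul_le_mul_of_nonneg_left h₁
      (mul_nonneg (abs_nonneg ((p - 1) * (p - 2) * (p - 3))) (pow_nonneg (abs_nonneg t) 3))]

end Scalar

/-! ### Expansion of J(u) + J(v) and the order γ -/

section ScalarExpansion

theorem gammaExp_two : gammaExp 2 = 2 := by simp [gammaExp]

theorem gammaExp_of_lt {p : ℝ} (h₂ : 2 < p) (h₄ : p < 4) : gammaExp p = p - 2 := by
  simp [gammaExp, h₂.ne', not_le.2 h₄]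

theorem gammaExp_of_le {p : ℝ} (h₄ : 4 ≤ p) : gammaExp p = 2 := by simp [gammaExp, h₄]

theorem gammaExp_le_two (p : ℝ) (hp : 2 ≤ p) : gammaExp p ≤ 2 := by
  rcases hp.eq_or_lt with rfl | h₂
  · rw [gammaExp_two]
  · rcases lt_or_ge p 4 with h₄ | h₄
    · rw [gammaExp_of_lt h₂ h₄]; linarith
    · rw [gammaExp_of_le h₄]

theorem gammaExp_pos (p : ℝ) (hp : 2 ≤ p) : 0 < gammaExp p := by
  rcases hp.eq_or_lt with rfl | h₂
  · rw [gammaExp_two]; norm_num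
  · rcases lt_or_ge p 4 with h₄ | h₄
    · rw [gammaExp_of_lt h₂ h₄]; linarith
    · rw [gammaExp_of_le h₄]; norm_num

/-- J is multiplicative, so J(A) factors out and the case A = 1, t = B/A applies; |A|^(p-1) |B/A|^3
is the stated error. -/
theorem abs_J_add_sub_le_of_two_mul_le {p : ℝ} (hp : 2 ≤ p) :
    ∃ C : ℝ, 0 ≤ C ∧ ∀ A B : ℝ, A ≠ 0 → 2 * |B| ≤ |A| →
      |J p (A + B) - J p (A - B) - 2 * ((p - 1) * |A| ^ (p - 2)) * B| ≤
        C * (|A| ^ (p - 4) * |B| ^ 3) := by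
  obtain ⟨C, hC, h⟩ := abs_J_one_add_sub_le hp
  refine ⟨C, hC, fun A B hA hAB => ?_⟩
  have hA' : 0 < |A| := abs_pos.2 hA
  have ht : |B / A| ≤ 1 / 2 := by
    rw [abs_div, div_le_iff₀ hA']; linarith
  have e : J p (A + B) - J p (A - B) - 2 * ((p - 1) * |A| ^ (p - 2)) * B =
      J p A * (J p (1 + B / A) - J p (1 - B / A) - 2 * (p - 1) * (B / A)) := by
    rw [mul_sub, mul_sub, ← J_mul, ← J_mul]
    have h₁ : A * (1 + B / A) = A + B := by field_simp
    have h₂ : A * (1 - B / A) = A - B := by field_simp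
    rw [h₁, h₂]
    congr 1
    rw [J]
    field_simp
  have e₂ : |A| ^ (p - 1) = |A| ^ (p - 4) * |A| ^ 3 := by
    rw [← Real.rpow_natCast, ← Real.rpow_add hA']
    congr 1
    push_cast
    ring
  rw [e, abs_mul, abs_J hp]
  calc |A| ^ (p - 1) * |J p (1 + B / A) - J p (1 - B / A) - 2 * (p - 1) * (B / A)|
      ≤ |A| ^ (p - 1) * (C * |B / A| ^ 3) := by gcongr; exact h _ ht
    _ = C * (|A| ^ (p - 4) * |B| ^ 3) := by
      rw [e₂, abs_div]
      field_simp

/-- The degenerate regime: no cancellation is used, since each of the three terms is separately of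
size |B|^(p-1). -/
theorem abs_J_add_sub_le_of_le_two_mul {p : ℝ} (hp : 2 ≤ p) {A B : ℝ} (hAB : |A| ≤ 2 * |B|) :
    |J p (A + B) - J p (A - B) - 2 * ((p - 1) * |A| ^ (p - 2)) * B| ≤
      (2 * 3 ^ (p - 1) + 2 * (p - 1) * 2 ^ (p - 2)) * |B| ^ (p - 1) := by
  have h₁ : |J p (A + B)| ≤ 3 ^ (p - 1) * |B| ^ (p - 1) := by
    rw [abs_J hp, ← Real.mul_rpow (by norm_num) (abs_nonneg B)]
    exact Real.rpow_le_rpow (abs_nonneg _) ((abs_add_le _ _).trans (by linarith)) (by linarith)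
  have h₂ : |J p (A - B)| ≤ 3 ^ (p - 1) * |B| ^ (p - 1) := by
    rw [abs_J hp, ← Real.mul_rpow (by norm_num) (abs_nonneg B)]
    exact Real.rpow_le_rpow (abs_nonneg _) ((abs_sub _ _).trans (by linarith)) (by linarith)
  have h₃ : |2 * ((p - 1) * |A| ^ (p - 2)) * B| ≤ 2 * (p - 1) * 2 ^ (p - 2) * |B| ^ (p - 1) := by
    rw [abs_mul, abs_of_nonneg (mul_nonneg zero_le_two
      (mul_nonneg (by linarith) (Real.rpow_nonneg (abs_nonneg A) _))),
      ← abs_rpow_sub_two_mul_abs hp]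
    have : |A| ^ (p - 2) ≤ 2 ^ (p - 2) * |B| ^ (p - 2) := by
      rw [← Real.mul_rpow (by norm_num) (abs_nonneg B)]
      exact Real.rpow_le_rpow (abs_nonneg _) hAB (by linarith)
    have hp₁ : 0 ≤ 2 * (p - 1) := by linarith
    calc 2 * ((p - 1) * |A| ^ (p - 2)) * |B| = 2 * (p - 1) * |A| ^ (p - 2) * |B| := by ring
      _ ≤ 2 * (p - 1) * (2 ^ (p - 2) * |B| ^ (p - 2)) * |B| := by gcongr
      _ = _ := by ring
  calc _ ≤ |J p (A + B)| + |J p (A - B)| + |2 * ((p - 1) * |A| ^ (p - 2)) * B| :=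
        (abs_sub _ _).trans (add_le_add (abs_sub _ _) le_rfl)
    _ ≤ _ := by linarith

theorem mul_rpow_le_mul_rpow {K ρ a b e : ℝ} (hK : 0 ≤ K) (h₀ : 0 < ρ) (h₁ : ρ ≤ 1)
    (h : e ≤ a * b) : (K * ρ ^ a) ^ b ≤ K ^ b * ρ ^ e := by
  rw [Real.mul_rpow hK (Real.rpow_nonneg h₀.le _), ← Real.rpow_mul h₀.le]
  exact mul_le_mul_of_nonneg_left (Real.rpow_le_rpow_of_exponent_ge h₀ h₁ h)
    (Real.rpow_nonneg hK _)

/-- Both regimes are put on the scale |A| ≲ ρ, |B| ≲ ρ². The degenerate one gives ρ^(2p-2). The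
other gives ρ^(p-4) ρ^6 = ρ^(p+2) when p ≥ 4; for p < 4 the power |A|^(p-4) has no upper bound in ρ,
and the error is again compared with |B|^(p-1). -/
theorem abs_J_add_sub_le {p : ℝ} (hp : 2 ≤ p) {K : ℝ} (hK : 0 ≤ K) :
    ∃ C : ℝ, 0 ≤ C ∧ ∀ ρ A B : ℝ, 0 < ρ → ρ ≤ 1 → |A| ≤ K * ρ → |B| ≤ K * ρ ^ 2 →
      |J p (A + B) - J p (A - B) - 2 * ((p - 1) * |A| ^ (p - 2)) * B| ≤
        C * ρ ^ (p + gammaExp p) := by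
  rcases hp.eq_or_lt with rfl | h₂
  · refine ⟨0, le_rfl, fun ρ A B _ _ _ _ => ?_⟩
    rw [J_two, J_two, sub_self, Real.rpow_zero, zero_mul, abs_nonpos_iff]
    ring
  obtain ⟨C₁, hC₁, h₁⟩ := abs_J_add_sub_le_of_two_mul_le hp
  obtain ⟨C₂, hC₂⟩ : ∃ C₂ : ℝ, C₂ = 2 * 3 ^ (p - 1) + 2 * (p - 1) * 2 ^ (p - 2) := ⟨_, rfl⟩
  have hC₂' : 0 ≤ C₂ := by
    have : 0 ≤ p - 1 := by linarith
    rw [hC₂]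
    positivity
  have hKρ : ∀ ρ B : ℝ, 0 < ρ → ρ ≤ 1 → |B| ≤ K * ρ ^ 2 →
      |B| ^ (p - 1) ≤ K ^ (p - 1) * ρ ^ (p + gammaExp p) := by
    intro ρ B h₀ h₁ hB
    rw [← Real.rpow_natCast] at hB
    refine (Real.rpow_le_rpow (abs_nonneg _) hB (by linarith)).trans
      (mul_rpow_le_mul_rpow hK h₀ h₁ ?_)
    push_cast
    rcases lt_or_ge p 4 with h₄ | h₄
    · rw [gammaExp_of_lt h₂ h₄]; linarith
    · rw [gammaExp_of_le h₄]; linarith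
  rcases lt_or_ge p 4 with h₄ | h₄
  · refine ⟨(C₁ + C₂) * K ^ (p - 1), by positivity, fun ρ A B h₀ hρ hA hB => ?_⟩
    have h₃ := hKρ ρ B h₀ hρ hB
    have h₅ : 0 ≤ |B| ^ (p - 1) := Real.rpow_nonneg (abs_nonneg B) _
    rw [mul_assoc (C₁ + C₂)]
    rcases le_or_gt |A| (2 * |B|) with h | h
    · refine (abs_J_add_sub_le_of_le_two_mul hp h).trans ?_
      rw [← hC₂]
      nlinarith
    · have hA0 : A ≠ 0 := abs_pos.1 ((by positivity : 0 ≤ 2 * |B|).trans_lt h)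
      refine (h₁ A B hA0 h.le).trans ?_
      -- The exponent p - 4 is negative and |A| ≥ |B|, so |A| may be replaced by |B|.
      have : |A| ^ (p - 4) * |B| ^ 3 ≤ |B| ^ (p - 1) := by
        rcases eq_or_ne B 0 with rfl | hB0
        · simp [Real.zero_rpow (by linarith : p - 1 ≠ 0)]
        · have hB' := abs_pos.2 hB0
          calc |A| ^ (p - 4) * |B| ^ 3 ≤ |B| ^ (p - 4) * |B| ^ 3 := by
                gcongr ?_ * _
                exact Real.rpow_le_rpow_of_nonpos hB' (by linarith) (by linarith)
            _ = |B| ^ (p - 1) := by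
                rw [← Real.rpow_natCast, ← Real.rpow_add hB']
                congr 1
                push_cast
                ring
      nlinarith
  · refine ⟨C₁ * (K ^ (p - 4) * K ^ 3) + C₂ * K ^ (p - 1), by positivity,
      fun ρ A B h₀ hρ hA hB => ?_⟩
    have h₃ := hKρ ρ B h₀ hρ hB
    have h₅ : 0 ≤ ρ ^ (p + gammaExp p) := Real.rpow_nonneg h₀.le _
    have h₆ : 0 ≤ K ^ (p - 1) := Real.rpow_nonneg hK _
    have h₇ : 0 ≤ K ^ (p - 4) * K ^ 3 := by positivity
    rcases le_or_gt |A| (2 * |B|) with h | h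
    · refine (abs_J_add_sub_le_of_le_two_mul hp h).trans ?_
      rw [← hC₂, add_mul, mul_assoc C₂]
      have := mul_le_mul_of_nonneg_left h₃ hC₂'
      have := mul_nonneg (mul_nonneg hC₁ h₇) h₅
      linarith
    · have hA0 : A ≠ 0 := abs_pos.1 ((by positivity : 0 ≤ 2 * |B|).trans_lt h)
      refine (h₁ A B hA0 h.le).trans ?_
      have : |A| ^ (p - 4) * |B| ^ 3 ≤ K ^ (p - 4) * K ^ 3 * ρ ^ (p + gammaExp p) := by
        calc |A| ^ (p - 4) * |B| ^ 3 ≤ (K * ρ) ^ (p - 4) * (K * ρ ^ 2) ^ 3 := by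
              gcongr
          _ = K ^ (p - 4) * K ^ 3 * (ρ ^ (p - 4) * ρ ^ (6 : ℝ)) := by
              rw [Real.mul_rpow hK h₀.le]
              norm_cast
              ring
          _ = _ := by
              rw [← Real.rpow_add h₀, gammaExp_of_le h₄]
              congr 2
              ring
      have := mul_le_mul_of_nonneg_left this hC₁
      have := mul_nonneg (mul_nonneg hC₂' h₆) h₅
      linarith

theorem abs_rpow_sub_rpow_le {q x y : ℝ} (hq₀ : 0 ≤ q) (hq₁ : q ≤ 1) (hx : 0 ≤ x) (hy : 0 ≤ y) :
    |x ^ q - y ^ q| ≤ |x - y| ^ q := by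
  wlog h : y ≤ x generalizing x y
  · rw [abs_sub_comm, abs_sub_comm x]
    exact this hy hx (le_of_not_ge h)
  rw [abs_of_nonneg (sub_nonneg.2 (Real.rpow_le_rpow hy h hq₀)), abs_of_nonneg (sub_nonneg.2 h)]
  have := Real.rpow_add_le_add_rpow hy (sub_nonneg.2 h) hq₀ hq₁
  rw [add_sub_cancel] at this
  linarith

theorem abs_rpow_sub_rpow_le_of_one_le {q x y X : ℝ} (hq : 1 ≤ q) (hx : x ∈ Icc 0 X)
    (hy : y ∈ Icc 0 X) : |x ^ q - y ^ q| ≤ q * X ^ (q - 1) * |x - y| := by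
  refine (convex_Icc (0 : ℝ) X).norm_image_sub_le_of_norm_hasDerivWithin_le
    (f := fun u => u ^ q)
    (fun u _ => (Real.hasDerivAt_rpow_const (Or.inr hq)).hasDerivWithinAt) (fun u hu => ?_) hy hx
  rw [Real.norm_eq_abs, abs_of_nonneg (mul_nonneg (by linarith) (Real.rpow_nonneg hu.1 _))]
  exact mul_le_mul_of_nonneg_left (Real.rpow_le_rpow hu.1 hu.2 (by linarith)) (by linarith)

/-- The price of replacing the odd increment A' by its linear part A inside J'. For p ≤ 3 the power
p - 2 is only Hölder continuous, which gives ρ^(3(p-2)) ρ^2; for p > 3 the mean value inequality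
gives ρ^(p-3) ρ^3 ρ^2. -/
theorem abs_rpow_sub_two_sub_mul_le {p : ℝ} (hp : 2 ≤ p) {K : ℝ} (hK : 0 ≤ K) :
    ∃ C : ℝ, 0 ≤ C ∧ ∀ ρ A A' B : ℝ, 0 < ρ → ρ ≤ 1 → |A| ≤ K * ρ → |A'| ≤ K * ρ →
      |A' - A| ≤ K * ρ ^ 3 → |B| ≤ K * ρ ^ 2 →
      |(|A'| ^ (p - 2) - |A| ^ (p - 2)) * B| ≤ C * ρ ^ (p + gammaExp p) := by
  rcases hp.eq_or_lt with rfl | h₂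
  · exact ⟨0, le_rfl, fun ρ A A' B _ _ _ _ _ _ => by simp⟩
  have hABS : ∀ A A' : ℝ, |(|A'| - |A|)| ≤ |A' - A| := fun A A' => abs_abs_sub_abs_le_abs_sub A' A
  rcases le_or_gt p 3 with h₃ | h₃
  · refine ⟨K ^ (p - 2) * K, by positivity, fun ρ A A' B h₀ h₁ hA hA' hAA hB => ?_⟩
    rw [gammaExp_of_lt h₂ (by linarith), abs_mul]
    have h₅ : |(|A'| ^ (p - 2) - |A| ^ (p - 2))| ≤ K ^ (p - 2) * ρ ^ (2 * p - 4) := by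
      refine (abs_rpow_sub_rpow_le (by linarith) (by linarith) (abs_nonneg _)
        (abs_nonneg _)).trans ?_
      rw [← Real.rpow_natCast] at hAA
      refine (Real.rpow_le_rpow (abs_nonneg _) ((hABS A A').trans hAA) (by linarith)).trans
        -- The exponent 3(p-2) is weakened to 2p - 4, which is all that γ = p - 2 requires.
        (mul_rpow_le_mul_rpow hK h₀ h₁ ?_)
      push_cast
      linarith
    calc _ ≤ K ^ (p - 2) * ρ ^ (2 * p - 4) * (K * ρ ^ 2) := by gcongr
      _ = K ^ (p - 2) * K * (ρ ^ (2 * p - 4) * ρ ^ (2 : ℝ)) := by norm_cast; ring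
      _ = _ := by
        rw [← Real.rpow_add h₀]
        congr 2
        ring
  · refine ⟨(p - 2) * K ^ (p - 3) * K * K, ?_, fun ρ A A' B h₀ h₁ hA hA' hAA hB => ?_⟩
    · have : 0 ≤ p - 2 := by linarith
      positivity
    have hp₂ : 0 ≤ p - 2 := by linarith
    have h₅ : |(|A'| ^ (p - 2) - |A| ^ (p - 2))| ≤ (p - 2) * (K * ρ) ^ (p - 3) * (K * ρ ^ 3) := by
      refine (abs_rpow_sub_rpow_le_of_one_le (X := K * ρ) (by linarith) ⟨abs_nonneg _, hA'⟩
        ⟨abs_nonneg _, hA⟩).trans ?_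
      rw [show p - 2 - 1 = p - 3 by ring]
      have := (hABS A A').trans hAA
      gcongr
    rw [abs_mul]
    calc _ ≤ (p - 2) * (K * ρ) ^ (p - 3) * (K * ρ ^ 3) * (K * ρ ^ 2) := by gcongr
      _ = (p - 2) * K ^ (p - 3) * K * K * (ρ ^ (p - 3) * ρ ^ (5 : ℝ)) := by
        rw [Real.mul_rpow hK h₀.le]
        norm_cast
        ring
      _ = (p - 2) * K ^ (p - 3) * K * K * ρ ^ (p + 2) := by
        rw [← Real.rpow_add h₀]
        congr 2
        ring
      _ ≤ _ := by
        gcongr ?_ * ?_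
        exact Real.rpow_le_rpow_of_exponent_ge h₀ h₁ (by linarith [gammaExp_le_two p hp])

/-- Expansion of `J_p(u) + J_p(v)` when `u` and `v` are close to `± α` with mean close to `β / 2`. -/
theorem abs_J_add_J_sub_le {p : ℝ} (hp : 2 ≤ p) {K : ℝ} (hK : 0 ≤ K) :
    ∃ C : ℝ, 0 ≤ C ∧ ∀ ρ u v α β : ℝ, 0 < ρ → ρ ≤ 1 → |α| ≤ K * ρ → |β| ≤ K * ρ ^ 2 →
      |u - v - 2 * α| ≤ K * ρ ^ 3 → |u + v - β| ≤ K * ρ ^ 4 →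
      |J p u + J p v - (p - 1) * |α| ^ (p - 2) * β| ≤ C * ρ ^ (p + gammaExp p) := by
  have h2K : 0 ≤ 2 * K := by linarith
  obtain ⟨C₁, hC₁, h₁⟩ := abs_J_add_sub_le hp h2K
  obtain ⟨C₂, hC₂, h₂⟩ := abs_rpow_sub_two_sub_mul_le hp h2K
  have hp₁ : 0 ≤ p - 1 := by linarith
  refine ⟨C₁ + 2 * (p - 1) * C₂ + (p - 1) * K ^ (p - 2) * K, by positivity,
    fun ρ u v α β h₀ hρ hα hβ huv huv' => ?_⟩
  set A := (u - v) / 2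
  set B := (u + v) / 2
  have hA : A - α = (u - v - 2 * α) / 2 := by ring
  have hB : B = (u + v - β) / 2 + β / 2 := by ring
  have hρ₂ : ρ ^ 3 ≤ ρ := by nlinarith [mul_pos h₀ h₀]
  have hρ₃ : ρ ^ 4 ≤ ρ ^ 2 := by nlinarith [mul_pos h₀ h₀]
  have hAα : |A - α| ≤ 2 * K * ρ ^ 3 := by
    rw [hA, abs_div, abs_two]
    have : 0 ≤ K * ρ ^ 3 := by positivity
    linarith
  have hA' : |A| ≤ 2 * K * ρ := by
    have h₃ : |A - α| ≤ K * ρ ^ 3 := by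
      rw [hA, abs_div, abs_two]
      have : 0 ≤ K * ρ ^ 3 := by positivity
      linarith
    have h₄ := abs_add_le (A - α) α
    rw [sub_add_cancel] at h₄
    nlinarith
  have hB' : |B| ≤ 2 * K * ρ ^ 2 := by
    rw [hB]
    refine (abs_add_le _ _).trans ?_
    rw [abs_div, abs_div, abs_two]
    nlinarith [abs_nonneg (u + v - β), abs_nonneg β]
  have e₁ := h₁ ρ A B h₀ hρ hA' hB'
  have e₂ := h₂ ρ α A B h₀ hρ (by nlinarith) hA' hAα hB'
  have e₃ : |(p - 1) * |α| ^ (p - 2) * (u + v - β)| ≤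
      (p - 1) * K ^ (p - 2) * K * ρ ^ (p + gammaExp p) := by
    rw [abs_mul, abs_of_nonneg (mul_nonneg hp₁ (Real.rpow_nonneg (abs_nonneg α) _))]
    calc _ ≤ (p - 1) * (K * ρ) ^ (p - 2) * (K * ρ ^ 4) := by
          gcongr
      _ = (p - 1) * K ^ (p - 2) * K * (ρ ^ (p - 2) * ρ ^ (4 : ℝ)) := by
          rw [Real.mul_rpow hK h₀.le]
          norm_cast
          ring
      _ = (p - 1) * K ^ (p - 2) * K * ρ ^ (p + 2) := by
          rw [← Real.rpow_add h₀]
          congr 2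
          ring
      _ ≤ _ := by
          gcongr ?_ * ?_
          exact Real.rpow_le_rpow_of_exponent_ge h₀ hρ (by linarith [gammaExp_le_two p hp])
  have hu : A + B = u := by ring
  have hv : J p (A - B) = - J p v := by
    rw [← J_neg]
    congr 1
    ring
  rw [hu, hv] at e₁
  -- Three errors: expanding J around A, replacing A by α in J', and replacing 2B by β.
  have e : J p u + J p v - (p - 1) * |α| ^ (p - 2) * β =
      (J p u - -J p v - 2 * ((p - 1) * |A| ^ (p - 2)) * B) +
      2 * (p - 1) * ((|A| ^ (p - 2) - |α| ^ (p - 2)) * B) +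
      (p - 1) * |α| ^ (p - 2) * (u + v - β) := by
    rw [show u + v - β = 2 * B - β by ring]
    ring
  rw [e]
  refine (abs_add_three _ _ _).trans ?_
  rw [abs_mul (2 * (p - 1)), abs_of_nonneg (by linarith : 0 ≤ 2 * (p - 1))]
  have := mul_le_mul_of_nonneg_left e₂ (by linarith : 0 ≤ 2 * (p - 1))
  linarith

end ScalarExpansion

/-! ### The symmetrized increment and its leading term -/

section Pointwise

theorem hasDerivAt_iteratedFDeriv_line {E : Type*} [NormedAddCommGroup E] [NormedSpace ℝ E]
    {φ : E → ℝ} {n k : ℕ} (hk : k < n) {z y : E} {t : ℝ} (hφ : ContDiffAt ℝ n φ (z + t • y)) :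
    HasDerivAt (fun t : ℝ => iteratedFDeriv ℝ k φ (z + t • y) fun _ => y)
      (iteratedFDeriv ℝ (k + 1) φ (z + t • y) fun _ => y) t := by
  have h₁ := (hφ.differentiableAt_iteratedFDeriv (Nat.cast_lt.2 hk)).hasFDerivAt
  have h₂ : HasDerivAt (fun t : ℝ => z + t • y) y t := by
    simpa using ((hasDerivAt_id t).smul_const y).const_add z
  have h₃ := h₁.comp_hasDerivAt t h₂
  have h₄ := ((ContinuousMultilinearMap.apply ℝ (fun _ : Fin k => E) ℝ
    fun _ => y).hasFDerivAt).comp_hasDerivAt t h₃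
  exact h₄

/-- The `p`-homogeneous leading term of the symmetrized increment `J_p(φ(z+y) - φ(z))`. -/
def leadingTerm {d : ℕ} (p : ℝ) (φ : EuclideanSpace ℝ (Fin d) → ℝ)
    (z y : EuclideanSpace ℝ (Fin d)) : ℝ :=
  (p - 1) * |fderiv ℝ φ z y| ^ (p - 2) * iteratedFDeriv ℝ 2 φ z fun _ => y

theorem leadingTerm_smul {d : ℕ} (p : ℝ) (φ : EuclideanSpace ℝ (Fin d) → ℝ)
    (z y : EuclideanSpace ℝ (Fin d)) {t : ℝ} (ht : 0 < t) :
    leadingTerm p φ z (t • y) = t ^ p * leadingTerm p φ z y := by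
  have h := (iteratedFDeriv ℝ 2 φ z).map_smul_univ (fun _ => t) fun _ => y
  simp only [Finset.prod_const, Finset.card_univ, Fintype.card_fin, smul_eq_mul] at h
  have h₂ : t ^ p = t ^ (p - 2) * t ^ 2 := by
    rw [← Real.rpow_natCast, ← Real.rpow_add ht]
    norm_num
  simp only [leadingTerm]
  rw [h, map_smul, smul_eq_mul, abs_mul, abs_of_pos ht, Real.mul_rpow ht.le (abs_nonneg _), h₂]
  ring

theorem MemCb.exists_bound {d k : ℕ} {φ : EuclideanSpace ℝ (Fin d) → ℝ}
    {Ω : Set (EuclideanSpace ℝ (Fin d))} (hφ : MemCb k φ Ω) :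
    ∃ K : ℝ, 0 ≤ K ∧ ∀ j ≤ k, ∀ y ∈ Ω, ‖iteratedFDeriv ℝ j φ y‖ ≤ K := by
  choose! K hK using hφ.2
  refine ⟨∑ j ∈ Finset.range (k + 1), |K j|, Finset.sum_nonneg fun _ _ => abs_nonneg _,
    fun j hj y hy => (hK j hj y hy).trans ((le_abs_self _).trans ?_)⟩
  exact Finset.single_le_sum (f := fun j => |K j|) (fun _ _ => abs_nonneg _)
    (Finset.mem_range.2 (Nat.lt_succ_of_le hj))

theorem add_mem_ball_of_mem_ball_half {E : Type*} [SeminormedAddCommGroup E] {x z y : E} {R : ℝ}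
    (hz : z ∈ ball x (R / 2)) (hy : ‖y‖ < R / 2) : z + y ∈ ball x R := by
  rw [mem_ball, dist_eq_norm] at *
  calc ‖z + y - x‖ = ‖(z - x) + y‖ := by congr 1; abel
    _ ≤ ‖z - x‖ + ‖y‖ := norm_add_le _ _
    _ < R := by linarith

/-- The symmetrized increment equals its leading term up to an error of order `p + γ`. -/
theorem exists_abs_J_add_J_sub_leadingTerm_le {d : ℕ} {p : ℝ} (hp : 2 ≤ p)
    {x : EuclideanSpace ℝ (Fin d)} {R : ℝ} (hR : R < 1)
    {φ : EuclideanSpace ℝ (Fin d) → ℝ} (hφ : MemCb 4 φ (ball x R)) :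
    ∃ C : ℝ, 0 ≤ C ∧ ∀ z ∈ ball x (R / 2), ∀ y, ‖y‖ < R / 2 →
      |J p (φ (z + y) - φ z) + J p (φ (z + -y) - φ z) - leadingTerm p φ z y| ≤
        C * ‖y‖ ^ (p + gammaExp p) := by
  obtain ⟨K, hK, hKb⟩ := hφ.exists_bound
  -- The factor 2 absorbs the one in the Taylor remainders. C depends only on p and K, hence is
  -- uniform in z.
  obtain ⟨C, hC, h⟩ := abs_J_add_J_sub_le hp (by linarith : 0 ≤ 2 * K)
  refine ⟨C, hC, fun z hz y hy => ?_⟩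
  rcases eq_or_ne y 0 with rfl | hy₀
  · have h₀ : iteratedFDeriv ℝ 2 φ z (fun _ => 0) = 0 :=
      (iteratedFDeriv ℝ 2 φ z).map_coord_zero 0 rfl
    have : J p 0 = 0 := by simp [J]
    have hγ := gammaExp_pos p hp
    simp [leadingTerm, h₀, this, Real.zero_rpow (by linarith : p + gammaExp p ≠ 0)]
  have hy' : 0 < ‖y‖ := norm_pos_iff.2 hy₀
  have hline : ∀ t ∈ Icc (-1 : ℝ) 1, z + t • y ∈ ball x R := fun t ht => by
    refine add_mem_ball_of_mem_ball_half hz ?_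
    rw [norm_smul]
    exact (mul_le_of_le_one_left hy'.le (abs_le.2 ht)).trans_lt hy
  set g : ℕ → ℝ → ℝ := fun k t => iteratedFDeriv ℝ k φ (z + t • y) fun _ => y with hg
  have hgd : ∀ k < 4, ∀ t ∈ Icc (-1 : ℝ) 1, HasDerivAt (g k) (g (k + 1) t) t := fun k hk t ht =>
    hasDerivAt_iteratedFDeriv_line hk (hφ.1.contDiffAt (isOpen_ball.mem_nhds (hline t ht)))
  have hgb : ∀ k ≤ 4, ∀ t ∈ Icc (-1 : ℝ) 1, |g k t| ≤ K * ‖y‖ ^ k := fun k hk t ht => by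
    refine ((iteratedFDeriv ℝ k φ (z + t • y)).le_opNorm _).trans ?_
    simp only [Finset.prod_const, Finset.card_univ, Fintype.card_fin]
    gcongr
    exact hKb k hk _ (hline t ht)
  have h0 : (0 : ℝ) ∈ Icc (-1 : ℝ) 1 := by norm_num
  have e₁ := abs_sub_sub_le_of_hasDerivAt (fun k hk => hgd k (by omega)) (hgb 3 (by norm_num))
  have e₂ := abs_add_sub_le_of_hasDerivAt hgd (hgb 4 le_rfl)
  have b₁ := hgb 1 (by norm_num) 0 h0
  have b₂ := hgb 2 (by norm_num) 0 h0
  have g₀ : ∀ t, g 0 t = φ (z + t • y) := fun t => rfl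
  have g₁ : g 1 0 = fderiv ℝ φ z y := by
    simp only [hg]
    rw [iteratedFDeriv_one_apply, zero_smul, add_zero]
  have g₂ : g 2 0 = iteratedFDeriv ℝ 2 φ z fun _ => y := by simp [hg]
  rw [g₁, g₀, g₀] at e₁
  rw [g₀, g₀, g₀, g₂] at e₂
  rw [g₁, pow_one] at b₁
  rw [g₂] at b₂
  rw [one_smul, neg_one_smul] at e₁ e₂
  rw [zero_smul, add_zero] at e₂
  refine h ‖y‖ _ _ _ _ hy' (by linarith) (by nlinarith) (by nlinarith [sq_nonneg ‖y‖]) ?_ ?_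
  · rw [show φ (z + y) - φ z - (φ (z + -y) - φ z) = φ (z + y) - φ (z + -y) by ring]
    linarith
  · rw [show φ (z + y) - φ z + (φ (z + -y) - φ z) = φ (z + y) + φ (z + -y) - 2 * φ z by ring]
    linarith

end Pointwise

theorem continuous_J_inner {E : Type*} [NormedAddCommGroup E] [InnerProductSpace ℝ E] {p : ℝ} (hp : 2 ≤ p) (a : E) :
    Continuous fun ω : sphere (0 : E) 1 => J p (inner ℝ a (ω : E)) :=
  (continuous_J hp).comp (by fun_prop)

/-! ### The field |a|^(p-2) a as a spherical integral -/

section Flux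

variable {E : Type*} [NormedAddCommGroup E] [InnerProductSpace ℝ E] [FiniteDimensional ℝ E]
  [MeasurableSpace E] [BorelSpace E]

theorem integrable_sphere_of_continuous {F : Type*} [NormedAddCommGroup F]
    {f : sphere (0 : E) 1 → F} (hf : Continuous f) :
    Integrable f (volume : Measure E).toSphere :=
  hf.integrable_of_hasCompactSupport (HasCompactSupport.of_compactSpace f)

theorem integral_sphere_abs_inner_rpow_pos {p : ℝ} (hp : 0 < p) {e : E} (he : ‖e‖ = 1) :
    0 < ∫ ω : sphere (0 : E) 1, |inner ℝ e (ω : E)| ^ p ∂(volume : Measure E).toSphere := by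
  have hc : Continuous fun ω : sphere (0 : E) 1 => |inner ℝ e (ω : E)| ^ p :=
    Continuous.rpow_const (by fun_prop) fun _ => Or.inr hp.le
  refine hc.integral_pos_of_hasCompactSupport_nonneg_nonzero (HasCompactSupport.of_compactSpace _)
    (fun ω => Real.rpow_nonneg (abs_nonneg _) _) (x := ⟨e, by simpa using he⟩) ?_
  simp [he]

/-- Differentiation under the integral: J is differentiable everywhere for p ≥ 2, and on the unit
ball around a the derivative is dominated by (p-1)(‖a‖+1)^(p-2). The point a = 0 needs no special
treatment. -/
theorem hasFDerivAt_integral_sphere_J {p : ℝ} (hp : 2 ≤ p) (a : E) :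
    HasFDerivAt (fun a : E => ∫ ω : sphere (0 : E) 1, J p (inner ℝ a (ω : E)) • (ω : E)
        ∂(volume : Measure E).toSphere)
      (∫ ω : sphere (0 : E) 1, ((p - 1) * |inner ℝ a (ω : E)| ^ (p - 2)) •
        (innerSL ℝ (ω : E)).smulRight (ω : E) ∂(volume : Measure E).toSphere) a := by
  have hp₁ : 0 ≤ p - 1 := by linarith
  have hcJ : ∀ a : E, Continuous fun ω : sphere (0 : E) 1 =>
      J p (inner ℝ a (ω : E)) • (ω : E) := fun a =>
    (continuous_J_inner hp a).smul continuous_subtype_val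
  refine hasFDerivAt_integral_of_dominated_of_fderiv_le
    (F := fun a (ω : sphere (0 : E) 1) => J p (inner ℝ a (ω : E)) • (ω : E))
    (F' := fun a (ω : sphere (0 : E) 1) => ((p - 1) * |inner ℝ a (ω : E)| ^ (p - 2)) •
        (innerSL ℝ (ω : E)).smulRight (ω : E))
    (bound := fun _ => (p - 1) * (‖a‖ + 1) ^ (p - 2))
    (ball_mem_nhds a one_pos)
    (Eventually.of_forall fun a => (integrable_sphere_of_continuous (hcJ a)).1)
    (integrable_sphere_of_continuous (hcJ a)) ?_ ?_ (integrable_const _) ?_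
  · refine (integrable_sphere_of_continuous ?_).1
    have h₁ : Continuous fun ω : sphere (0 : E) 1 => |inner ℝ a (ω : E)| ^ (p - 2) :=
      Continuous.rpow_const (by fun_prop) fun _ => Or.inr (by linarith)
    have h₂ : Continuous fun ω : sphere (0 : E) 1 => (innerSL ℝ (ω : E)).smulRight (ω : E) := by
      fun_prop
    exact (continuous_const.mul h₁).smul h₂
  · refine Eventually.of_forall fun ω b hb => ?_
    have hω : ‖(ω : E)‖ = 1 := by simp
    rw [norm_smul, ContinuousLinearMap.norm_smulRight_apply, innerSL_apply_norm, hω, mul_one,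
      mul_one, Real.norm_eq_abs, abs_of_nonneg
        (mul_nonneg hp₁ (Real.rpow_nonneg (abs_nonneg _) _))]
    have h₁ : |inner ℝ b (ω : E)| ≤ ‖b‖ := by
      simpa [hω] using abs_real_inner_le_norm b (ω : E)
    have h₂ : ‖b‖ ≤ ‖a‖ + 1 := by
      have := norm_le_norm_add_norm_sub' b a
      rw [mem_ball, dist_eq_norm] at hb
      rw [norm_sub_rev] at this
      rw [norm_sub_rev] at hb
      linarith
    exact mul_le_mul_of_nonneg_left
      (Real.rpow_le_rpow (abs_nonneg _) (h₁.trans h₂) (by linarith)) hp₁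
  · refine Eventually.of_forall fun ω b _ => ?_
    have h₁ : HasFDerivAt (fun b : E => inner ℝ b (ω : E)) (innerSL ℝ (ω : E)) b := by
      have := (innerSL ℝ (ω : E)).hasFDerivAt (x := b)
      refine this.congr_of_eventuallyEq (Eventually.of_forall fun y => ?_)
      simp [real_inner_comm]
    have h₂ := ((hasDerivAt_J hp (inner ℝ b (ω : E))).comp_hasFDerivAt b h₁).smul_const (ω : E)
    refine h₂.congr_fderiv ?_
    ext y
    simp [smul_smul]

variable [Nontrivial E]

/-- A reflection exchanges a and ‖a‖ e, which have equal norm, and preserves the surface measure. -/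
theorem integral_sphere_abs_inner_rpow {p : ℝ} (e : E) (he : ‖e‖ = 1) (a : E) :
    ∫ ω : sphere (0 : E) 1, |inner ℝ a (ω : E)| ^ p ∂(volume : Measure E).toSphere =
      ‖a‖ ^ p * ∫ ω : sphere (0 : E) 1, |inner ℝ e (ω : E)| ^ p ∂(volume : Measure E).toSphere := by
  have hT : ‖‖a‖ • e‖ = ‖a‖ := by rw [norm_smul, he, norm_norm, mul_one]
  set T : E ≃ₗᵢ[ℝ] E := (ℝ ∙ (‖a‖ • e - a))ᗮ.reflection
  have hTa : T (‖a‖ • e) = a := Submodule.reflection_sub hT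
  rw [← integral_sphere_comp_isometry T fun y => |inner ℝ a y| ^ p, ← integral_const_mul]
  congr 1
  funext ω
  nth_rewrite 1 [← hTa]
  rw [T.inner_map_map, real_inner_smul_left, abs_mul, abs_norm,
    Real.mul_rpow (norm_nonneg _) (abs_nonneg _)]

/-- Reflection in the hyperplane orthogonal to v fixes a and negates v, so it changes the sign of
the integrand. -/
theorem integral_sphere_J_inner_mul_inner_of_inner_eq_zero {p : ℝ} {a v : E}
    (h : inner ℝ a v = 0) :
    ∫ ω : sphere (0 : E) 1, J p (inner ℝ a (ω : E)) * inner ℝ v (ω : E)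
      ∂(volume : Measure E).toSphere = 0 := by
  set T : E ≃ₗᵢ[ℝ] E := (ℝ ∙ v)ᗮ.reflection
  have hTa : T a = a := Submodule.reflection_mem_subspace_eq_self
    (Submodule.mem_orthogonal_singleton_iff_inner_left.2 h)
  have hTv : T v = -v := Submodule.reflection_orthogonalComplement_singleton_eq_neg v
  have h₁ := integral_sphere_comp_isometry T fun y => J p (inner ℝ a y) * inner ℝ v y
  have h₂ : ∀ ω : sphere (0 : E) 1, J p (inner ℝ a (T ω)) * inner ℝ v (T ω) =
      -(J p (inner ℝ a (ω : E)) * inner ℝ v (ω : E)) := by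
    intro ω
    nth_rewrite 1 [← hTa]
    have hv : v = T (-v) := by rw [map_neg, hTv, neg_neg]
    nth_rewrite 1 [hv]
    rw [T.inner_map_map, T.inner_map_map, inner_neg_left, mul_neg]
  simp only [h₂, integral_neg] at h₁
  linarith

/-- The field `|a|^(p-2) a` is a spherical mean of `J_p(a · ω) ω`. -/
theorem integral_sphere_J_inner_smul {p : ℝ} (hp : 2 ≤ p) (e : E) (he : ‖e‖ = 1) (a : E) :
    ∫ ω : sphere (0 : E) 1, J p (inner ℝ a (ω : E)) • (ω : E) ∂(volume : Measure E).toSphere =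
      (∫ ω : sphere (0 : E) 1, |inner ℝ e (ω : E)| ^ p ∂(volume : Measure E).toSphere) •
        ‖a‖ ^ (p - 2) • a := by
  have hc := continuous_J_inner hp a
  have hI : ∀ v : E, Integrable (fun ω : sphere (0 : E) 1 =>
      J p (inner ℝ a (ω : E)) * inner ℝ v (ω : E)) (volume : Measure E).toSphere := fun v =>
    integrable_sphere_of_continuous (by fun_prop)
  refine ext_inner_left ℝ fun v => ?_
  rw [← integral_inner (integrable_sphere_of_continuous (by fun_prop))]
  simp only [real_inner_smul_right]
  rcases eq_or_ne a 0 with rfl | ha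
  · have : J p 0 = 0 := by simp [J]
    simp [this]
  have ha' : ‖a‖ ≠ 0 := norm_ne_zero_iff.2 ha
  -- The coefficient of the projection of v onto a; the orthogonal remainder contributes nothing.
  set c : ℝ := inner ℝ a v / ‖a‖ ^ 2
  have hw : inner ℝ a (v - c • a) = 0 := by
    rw [inner_sub_right, real_inner_smul_right, real_inner_self_eq_norm_sq]
    simp only [c]
    field_simp
    ring
  have h₁ := integral_sphere_J_inner_mul_inner_of_inner_eq_zero (p := p) hw
  have h₂ : ∀ ω : sphere (0 : E) 1, J p (inner ℝ a (ω : E)) * inner ℝ (v - c • a) (ω : E) =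
      J p (inner ℝ a (ω : E)) * inner ℝ v (ω : E) - c * |inner ℝ a (ω : E)| ^ p := by
    intro ω
    rw [inner_sub_left, real_inner_smul_left, ← J_mul_self hp]
    ring
  have h₃ : Integrable (fun ω : sphere (0 : E) 1 => c * |inner ℝ a (ω : E)| ^ p)
      (volume : Measure E).toSphere := by
    simp only [← J_mul_self hp]
    exact (hI a).const_mul c
  simp only [h₂] at h₁
  rw [integral_sub (hI v) h₃, integral_const_mul, sub_eq_zero,
    integral_sphere_abs_inner_rpow e he] at h₁
  rw [h₁, real_inner_comm]
  have h₄ : ‖a‖ ^ p = ‖a‖ ^ (p - 2) * ‖a‖ ^ 2 := by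
    rw [← Real.rpow_natCast, ← Real.rpow_add (norm_pos_iff.2 ha)]
    norm_num
  rw [h₄]
  simp only [c]
  field_simp

end Flux

/-! ### The p-Laplacian as a spherical integral of the leading term -/

section Laplacian

/-- The Riesz representation as a real linear continuous map. -/
def rieszRep (E : Type*) [NormedAddCommGroup E] [InnerProductSpace ℝ E] [CompleteSpace E] :
    StrongDual ℝ E →L[ℝ] E where
  toFun := (InnerProductSpace.toDual ℝ E).symm
  map_add' := map_add _
  map_smul' c l := by simp
  cont := (InnerProductSpace.toDual ℝ E).symm.continuous

theorem inner_gradient_eq_fderiv {d : ℕ}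
    (φ : EuclideanSpace ℝ (Fin d) → ℝ)
    (z v : EuclideanSpace ℝ (Fin d)) : inner ℝ (gradient φ z) v = fderiv ℝ φ z v := by
  rw [gradient, InnerProductSpace.toDual_symm_apply]

variable {d : ℕ} [NeZero d]

/-- The mass `∫_{∂B_1} |y_1|^p dσ`. -/
def sphereMass (p : ℝ) (d : ℕ) [NeZero d] : ℝ :=
  ∫ ω : sphere (0 : EuclideanSpace ℝ (Fin d)) 1,
    |inner ℝ (EuclideanSpace.single (0 : Fin d) (1 : ℝ)) (ω : EuclideanSpace ℝ (Fin d))| ^ p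
    ∂(volume : Measure (EuclideanSpace ℝ (Fin d))).toSphere

theorem sphereMass_pos {p : ℝ} (hp : 0 < p) : 0 < sphereMass p d :=
  integral_sphere_abs_inner_rpow_pos hp (by simp)

/-- Chain rule for the spherical representation of the flux composed with the gradient. -/
theorem hasFDerivAt_flux {p : ℝ} (hp : 2 ≤ p) {φ : EuclideanSpace ℝ (Fin d) → ℝ}
    {z : EuclideanSpace ℝ (Fin d)} (hφ : ContDiffAt ℝ 2 φ z) :
    HasFDerivAt (flux p φ) ((sphereMass p d)⁻¹ •
      (∫ ω : sphere (0 : EuclideanSpace ℝ (Fin d)) 1,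
        ((p - 1) * |inner ℝ (gradient φ z) (ω : EuclideanSpace ℝ (Fin d))| ^ (p - 2)) •
        (innerSL ℝ (ω : EuclideanSpace ℝ (Fin d))).smulRight (ω : EuclideanSpace ℝ (Fin d))
        ∂(volume : Measure (EuclideanSpace ℝ (Fin d))).toSphere).comp
      ((rieszRep (EuclideanSpace ℝ (Fin d))).comp (fderiv ℝ (fderiv ℝ φ) z))) z := by
  have h₁ : HasFDerivAt (fderiv ℝ φ) (fderiv ℝ (fderiv ℝ φ) z) z :=
    ((hφ.fderiv_right (m := 1) (by norm_num)).differentiableAt one_ne_zero).hasFDerivAt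
  have h₂ : HasFDerivAt (gradient φ)
      ((rieszRep (EuclideanSpace ℝ (Fin d))).comp (fderiv ℝ (fderiv ℝ φ) z)) z :=
    (rieszRep (EuclideanSpace ℝ (Fin d))).hasFDerivAt.comp z h₁
  have h₃ := ((hasFDerivAt_integral_sphere_J hp (gradient φ z)).comp z h₂).const_smul
    (sphereMass p d)⁻¹
  refine h₃.congr_of_eventuallyEq (Eventually.of_forall fun y => ?_)
  simp only [flux, Pi.smul_apply, Function.comp_apply]
  rw [integral_sphere_J_inner_smul hp (EuclideanSpace.single (0 : Fin d) (1 : ℝ)) (by simp),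
    ← sphereMass, smul_smul, inv_mul_cancel₀ (sphereMass_pos (by linarith)).ne', one_smul]

/-- Used with B = D²φ(z) and v = ω: taking the divergence contracts the derivative of the flux to
D²φ(ω,ω). -/
theorem sum_fderiv_single_mul {d : ℕ}
    (B : EuclideanSpace ℝ (Fin d) →L[ℝ] EuclideanSpace ℝ (Fin d) →L[ℝ] ℝ)
    (v : EuclideanSpace ℝ (Fin d)) : ∑ i, B (EuclideanSpace.single i 1) v * v i = B v v := by
  have h : v = ∑ i, v i • EuclideanSpace.single i (1 : ℝ) := by
    ext j
    simp [Finset.sum_apply, Pi.single_apply]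
  calc ∑ i, B (EuclideanSpace.single i 1) v * v i
      = B (∑ i, v i • EuclideanSpace.single i (1 : ℝ)) v := by simp [mul_comm]
    _ = B v v := by rw [← h]

/-- The `p`-Laplacian is a multiple of the spherical mean of the leading term. -/
theorem pLaplacian_eq {p : ℝ} (hp : 2 ≤ p) {φ : EuclideanSpace ℝ (Fin d) → ℝ}
    {z : EuclideanSpace ℝ (Fin d)} (hφ : ContDiffAt ℝ 2 φ z) :
    pLaplacian p φ z = (sphereMass p d)⁻¹ *
      ∫ ω : sphere (0 : EuclideanSpace ℝ (Fin d)) 1, leadingTerm p φ z ω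
        ∂(volume : Measure (EuclideanSpace ℝ (Fin d))).toSphere := by
  have hc : Continuous fun ω : sphere (0 : EuclideanSpace ℝ (Fin d)) 1 =>
      (p - 1) * |inner ℝ (gradient φ z) (ω : EuclideanSpace ℝ (Fin d))| ^ (p - 2) :=
    continuous_const.mul (Continuous.rpow_const (by fun_prop) fun _ => Or.inr (by linarith))
  have hI : Integrable (fun ω : sphere (0 : EuclideanSpace ℝ (Fin d)) 1 =>
      ((p - 1) * |inner ℝ (gradient φ z) (ω : EuclideanSpace ℝ (Fin d))| ^ (p - 2)) •
        (innerSL ℝ (ω : EuclideanSpace ℝ (Fin d))).smulRight (ω : EuclideanSpace ℝ (Fin d)))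
      (volume : Measure (EuclideanSpace ℝ (Fin d))).toSphere :=
    integrable_sphere_of_continuous (hc.smul (by fun_prop))
  have hcoord : ∀ i : Fin d,
      (fderiv ℝ (flux p φ) z (EuclideanSpace.single i 1)) i = (sphereMass p d)⁻¹ *
        ∫ ω : sphere (0 : EuclideanSpace ℝ (Fin d)) 1,
          (p - 1) * |fderiv ℝ φ z ω| ^ (p - 2) *
          (fderiv ℝ (fderiv ℝ φ) z (EuclideanSpace.single i 1) ω *
            (ω : EuclideanSpace ℝ (Fin d)) i)
          ∂(volume : Measure (EuclideanSpace ℝ (Fin d))).toSphere := by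
    intro i
    rw [(hasFDerivAt_flux hp hφ).fderiv]
    simp only [_root_.smul_apply, ContinuousLinearMap.comp_apply, PiLp.smul_apply,
      smul_eq_mul]
    rw [ContinuousLinearMap.integral_apply hI]
    congr 1
    refine ((EuclideanSpace.proj i : EuclideanSpace ℝ (Fin d) →L[ℝ] ℝ).integral_comp_comm
      (hI.apply_continuousLinearMap _)).symm.trans ?_
    congr 1
    funext ω
    simp only [_root_.smul_apply, ContinuousLinearMap.smulRight_apply,
      PiLp.proj_apply, PiLp.smul_apply, smul_eq_mul, inner_gradient_eq_fderiv,
      innerSL_apply_apply]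
    rw [real_inner_comm]
    congr 2
    exact InnerProductSpace.toDual_symm_apply
  have hI₂ : ∀ i : Fin d, Integrable (fun ω : sphere (0 : EuclideanSpace ℝ (Fin d)) 1 =>
          (p - 1) * |fderiv ℝ φ z ω| ^ (p - 2) *
          (fderiv ℝ (fderiv ℝ φ) z (EuclideanSpace.single i 1) ω *
            (ω : EuclideanSpace ℝ (Fin d)) i))
          (volume : Measure (EuclideanSpace ℝ (Fin d))).toSphere := by
    intro i
    refine integrable_sphere_of_continuous ?_
    simp only [inner_gradient_eq_fderiv] at hc
    exact hc.mul (by fun_prop)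
  rw [pLaplacian, divergence]
  simp only [hcoord]
  rw [← Finset.mul_sum, ← integral_finsetSum _ fun i _ => hI₂ i]
  congr 2
  funext ω
  rw [← Finset.mul_sum, sum_fderiv_single_mul, leadingTerm, iteratedFDeriv_two_apply]

end Laplacian

/-! ### Symmetrization, averages and principal values -/

section Averages

theorem setIntegral_comp_neg {E : Type*} [NormedAddCommGroup E] [MeasurableSpace E] [BorelSpace E]
    (μ : Measure E) [μ.IsNegInvariant] {A : Set E} (hA : MeasurableSet A)
    (hneg : ∀ y, -y ∈ A ↔ y ∈ A) (f : E → ℝ) : ∫ y in A, f (-y) ∂μ = ∫ y in A, f y ∂μ := by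
  rw [← integral_indicator hA, ← integral_indicator hA, ← integral_neg_eq_self]
  congr 1
  funext y
  by_cases h : y ∈ A
  · rw [indicator_of_mem h, indicator_of_mem ((hneg y).2 h), neg_neg]
  · rw [indicator_of_notMem h, indicator_of_notMem (mt (hneg y).1 h)]

theorem integrableOn_comp_neg {E : Type*} [NormedAddCommGroup E] [MeasurableSpace E]
    [BorelSpace E] {μ : Measure E} [μ.IsNegInvariant] {A : Set E} (hA : MeasurableSet A)
    (hneg : ∀ y, -y ∈ A ↔ y ∈ A) {f : E → ℝ} (hf : IntegrableOn f A μ) :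
    IntegrableOn (fun y => f (-y)) A μ := by
  rw [← integrable_indicator_iff hA] at *
  refine (hf.comp_neg).congr (Eventually.of_forall fun y => ?_)
  by_cases h : y ∈ A
  · simp only [indicator_of_mem h, indicator_of_mem ((hneg y).2 h)]
  · simp only [indicator_of_notMem h, indicator_of_notMem (mt (hneg y).1 h)]

theorem setIntegral_add_comp_neg {E : Type*} [NormedAddCommGroup E] [MeasurableSpace E]
    [BorelSpace E] {μ : Measure E} [μ.IsNegInvariant] {A : Set E} (hA : MeasurableSet A)
    (hneg : ∀ y, -y ∈ A ↔ y ∈ A) {f : E → ℝ} (hf : IntegrableOn f A μ) :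
    ∫ y in A, (f y + f (-y)) ∂μ = 2 * ∫ y in A, f y ∂μ := by
  rw [integral_add hf (integrableOn_comp_neg hA hneg hf), setIntegral_comp_neg μ hA hneg]
  ring

theorem neg_mem_ball_zero_iff {E : Type*} [SeminormedAddCommGroup E] {r : ℝ} (y : E) :
    -y ∈ ball (0 : E) r ↔ y ∈ ball (0 : E) r := by simp

theorem exists_abs_le_mul_norm_rpow {E : Type*} [NormedAddCommGroup E] [NormedSpace ℝ E]
    [FiniteDimensional ℝ E] {Q : E → ℝ} {p : ℝ} (hp : 0 < p) (hQ : Continuous Q)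
    (hhom : ∀ t : ℝ, 0 < t → ∀ y, Q (t • y) = t ^ p * Q y) :
    ∃ B : ℝ, ∀ y, |Q y| ≤ B * ‖y‖ ^ p := by
  obtain ⟨B, hB⟩ := (isCompact_sphere (0 : E) 1).exists_bound_of_continuousOn hQ.continuousOn
  refine ⟨B, fun y => ?_⟩
  rcases eq_or_ne y 0 with rfl | hy
  -- Homogeneity at the origin reads Q(0) = 2^p Q(0), which forces Q(0) = 0.
  · have h := hhom 2 two_pos 0
    have h₂ : (1 : ℝ) < 2 ^ p := Real.one_lt_rpow one_lt_two hp
    rw [smul_zero] at h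
    have : Q 0 = 0 := by
      by_contra h₀
      exact h₂.ne (mul_right_cancel₀ h₀ (by rw [one_mul]; exact h))
    simp [this, Real.zero_rpow hp.ne']
  · have hy' := norm_pos_iff.2 hy
    have h := hhom ‖y‖ hy' (‖y‖⁻¹ • y)
    rw [smul_inv_smul₀ hy'.ne'] at h
    rw [h, abs_mul, abs_of_nonneg (Real.rpow_nonneg hy'.le _), mul_comm]
    refine mul_le_mul_of_nonneg_right (hB _ ?_) (Real.rpow_nonneg hy'.le _)
    simp [norm_smul, hy'.ne']

variable {E : Type*} [NormedAddCommGroup E] [InnerProductSpace ℝ E] [FiniteDimensional ℝ E]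
  [MeasurableSpace E] [BorelSpace E]

/-- Comparison with the integrable (1+‖y‖)^(-m): off the ball, 1 + ‖y‖ ≤ (1 + 1/ε)‖y‖. -/
theorem integrableOn_compl_ball_norm_rpow {m ε : ℝ} (hε : 0 < ε)
    (hm : (Module.finrank ℝ E : ℝ) < m) :
    IntegrableOn (fun y : E => ‖y‖ ^ (-m)) (ball 0 ε)ᶜ := by
  have hm₀ : 0 < m := (Nat.cast_nonneg _).trans_lt hm
  have h := ((integrable_one_add_norm (μ := (volume : Measure E)) hm).const_mul
    ((1 + 1 / ε) ^ m)).integrableOn (s := (ball 0 ε)ᶜ)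
  refine h.mono' (measurable_norm.pow_const _).aestronglyMeasurable ?_
  filter_upwards [ae_restrict_mem measurableSet_ball.compl] with y hy
  have hy : ε ≤ ‖y‖ := by simpa using hy
  have hy₀ : 0 < ‖y‖ := hε.trans_le hy
  rw [Real.norm_eq_abs, abs_of_nonneg (Real.rpow_nonneg hy₀.le _), Real.rpow_neg hy₀.le,
    Real.rpow_neg (by positivity), ← div_eq_mul_inv, inv_le_comm₀ (by positivity) (by positivity),
    inv_div, ← Real.div_rpow (by positivity) (by positivity)]
  refine Real.rpow_le_rpow (by positivity) ?_ hm₀.le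
  rw [div_le_iff₀ (by positivity)]
  have : 1 ≤ ‖y‖ * (1 / ε) := by
    rw [mul_one_div, le_div_iff₀ hε]; linarith
  linarith

variable [Nontrivial E] {g Q : E → ℝ} {p γ C r₀ : ℝ}

/-- Spherical means of a function whose even part is homogeneous up to a small error. -/
theorem abs_integral_sphere_sub_le (hg : ContinuousOn g (ball 0 r₀)) (hQ : Continuous Q)
    (hhom : ∀ t : ℝ, 0 < t → ∀ y, Q (t • y) = t ^ p * Q y)
    (hgQ : ∀ y, ‖y‖ < r₀ → |g y + g (-y) - Q y| ≤ C * ‖y‖ ^ (p + γ))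
    {r : ℝ} (hr : 0 < r) (hr₀ : r < r₀) :
    |2 * (∫ ω : sphere (0 : E) 1, g (r • (ω : E)) ∂(volume : Measure E).toSphere) -
        r ^ p * ∫ ω : sphere (0 : E) 1, Q ω ∂(volume : Measure E).toSphere| ≤
      C * (volume : Measure E).toSphere.real univ * r ^ (p + γ) := by
  have hn : ∀ ω : sphere (0 : E) 1, ‖r • (ω : E)‖ = r := fun ω => by
    rw [norm_smul, norm_eq_of_mem_sphere, mul_one, Real.norm_of_nonneg hr.le]
  have hc₁ : Continuous fun ω : sphere (0 : E) 1 => g (r • (ω : E)) :=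
    hg.comp_continuous (by fun_prop) fun ω => by rw [mem_ball_zero_iff, hn]; exact hr₀
  have hc₂ : Continuous fun ω : sphere (0 : E) 1 => g (-(r • (ω : E))) :=
    hg.comp_continuous (by fun_prop) fun ω => by rw [mem_ball_zero_iff, norm_neg, hn]; exact hr₀
  have hc₁₂ : Continuous fun ω : sphere (0 : E) 1 => g (r • (ω : E)) + g (-(r • (ω : E))) :=
    hc₁.add hc₂
  have hc₃ : Continuous fun ω : sphere (0 : E) 1 => Q (r • (ω : E)) :=
    hQ.comp (by fun_prop)
  have e₁ : ∫ ω : sphere (0 : E) 1, g (-(r • (ω : E))) ∂(volume : Measure E).toSphere =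
      ∫ ω : sphere (0 : E) 1, g (r • (ω : E)) ∂(volume : Measure E).toSphere := by
    simpa using integral_sphere_comp_neg fun y : E => g (r • y)
  have e₂ : 2 * (∫ ω : sphere (0 : E) 1, g (r • (ω : E)) ∂(volume : Measure E).toSphere) -
        r ^ p * ∫ ω : sphere (0 : E) 1, Q ω ∂(volume : Measure E).toSphere =
      ∫ ω : sphere (0 : E) 1, (g (r • (ω : E)) + g (-(r • (ω : E))) - Q (r • (ω : E)))
        ∂(volume : Measure E).toSphere := by
    rw [integral_sub (integrable_sphere_of_continuous hc₁₂)
      (integrable_sphere_of_continuous hc₃),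
      integral_add (integrable_sphere_of_continuous hc₁) (integrable_sphere_of_continuous hc₂), e₁]
    simp only [hhom r hr, integral_const_mul]
    ring
  rw [e₂, ← Real.norm_eq_abs]
  refine (norm_integral_le_of_norm_le_const (C := C * r ^ (p + γ))
    (Eventually.of_forall fun ω => ?_)).trans (le_of_eq (by ring))
  simpa only [hn, Real.norm_eq_abs] using hgQ (r • (ω : E)) (by rw [hn]; exact hr₀)

/-- Weighted integrals over balls of a function whose even part is homogeneous up to a small
error. -/
theorem abs_setIntegral_ball_sub_le (hp : 0 < p) (hγ : 0 ≤ γ) (hg : ContinuousOn g (ball 0 r₀))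
    (hQ : Continuous Q)
    (hhom : ∀ t : ℝ, 0 < t → ∀ y, Q (t • y) = t ^ p * Q y)
    (hgQ : ∀ y, ‖y‖ < r₀ → |g y + g (-y) - Q y| ≤ C * ‖y‖ ^ (p + γ))
    {k r : ℝ} (hr : 0 < r) (hr₀ : r < r₀) (hk : 0 < p + k + Module.finrank ℝ E) :
    IntegrableOn (fun y => (g y + g (-y)) * ‖y‖ ^ k) (ball 0 r) ∧
    |(∫ y in ball (0 : E) r, (g y + g (-y)) * ‖y‖ ^ k) -
        r ^ (p + k + Module.finrank ℝ E) / (p + k + Module.finrank ℝ E) *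
          ∫ ω : sphere (0 : E) 1, Q ω ∂(volume : Measure E).toSphere| ≤
      C * (volume : Measure E).toSphere.real univ *
        (r ^ (p + γ + k + Module.finrank ℝ E) / (p + γ + k + Module.finrank ℝ E)) := by
  obtain ⟨B, hB⟩ := exists_abs_le_mul_norm_rpow hp hQ hhom
  have hsub : ball (0 : E) r ⊆ ball 0 r₀ := ball_subset_ball hr₀.le
  have hgn : ContinuousOn (fun y => g (-y)) (ball 0 r₀) :=
    hg.comp continuous_neg.continuousOn fun y hy => (neg_mem_ball_zero_iff y).2 hy
  have hw : AEStronglyMeasurable (fun y : E => ‖y‖ ^ k) (volume.restrict (ball 0 r)) :=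
    (measurable_norm.pow_const _).aestronglyMeasurable
  have hne : ∀ᵐ y : E ∂volume.restrict (ball 0 r), 0 < ‖y‖ := by
    refine ae_restrict_of_ae ?_
    filter_upwards [measure_eq_zero_iff_ae_notMem.1 (measure_singleton (0 : E))] with y hy
    exact norm_pos_iff.2 hy
  have hIQ : IntegrableOn (fun y => Q y * ‖y‖ ^ k) (ball 0 r) := by
    refine ((integrableOn_ball_norm_rpow (m := p + k) r hk).const_mul B).mono'
      (hQ.aestronglyMeasurable.mul hw) ?_
    filter_upwards [hne] with y hy
    rw [norm_mul, Real.norm_eq_abs, Real.norm_of_nonneg (Real.rpow_nonneg hy.le _),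
      Real.rpow_add hy, ← mul_assoc]
    exact mul_le_mul_of_nonneg_right (hB y) (Real.rpow_nonneg hy.le _)
  have hk' : 0 < p + γ + k + Module.finrank ℝ E := by linarith
  have hIE₀ : IntegrableOn (fun y : E => C * ‖y‖ ^ (p + γ + k)) (ball 0 r) :=
    (integrableOn_ball_norm_rpow r hk').const_mul C
  have hbound : ∀ᵐ y : E ∂volume.restrict (ball 0 r),
      ‖(g y + g (-y) - Q y) * ‖y‖ ^ k‖ ≤ C * ‖y‖ ^ (p + γ + k) := by
    filter_upwards [hne, ae_restrict_mem measurableSet_ball] with y hy hyr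
    rw [norm_mul, Real.norm_eq_abs, Real.norm_of_nonneg (Real.rpow_nonneg hy.le _),
      Real.rpow_add hy _ k, ← mul_assoc]
    exact mul_le_mul_of_nonneg_right (hgQ y (mem_ball_zero_iff.1 (hsub hyr)))
      (Real.rpow_nonneg hy.le _)
  have hIE : IntegrableOn (fun y => (g y + g (-y) - Q y) * ‖y‖ ^ k) (ball 0 r) := by
    refine hIE₀.mono' (AEStronglyMeasurable.mul ?_ hw) hbound
    exact (((hg.add hgn).sub hQ.continuousOn).mono hsub).aestronglyMeasurable measurableSet_ball
  have hsum : (fun y => (g y + g (-y)) * ‖y‖ ^ k) =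
      fun y => (g y + g (-y) - Q y) * ‖y‖ ^ k + Q y * ‖y‖ ^ k := by
    funext y
    ring
  rw [hsum]
  refine ⟨hIE.add hIQ, ?_⟩
  rw [integral_add hIE hIQ, setIntegral_ball_homogeneous hr hk Q hhom, add_sub_cancel_right,
    ← Real.norm_eq_abs]
  refine (norm_integral_le_of_norm_le hIE₀ hbound).trans (le_of_eq ?_)
  rw [integral_const_mul, setIntegral_ball_norm_rpow hr hk']
  ring

/-- The principal value of a singular integral, as a tail plus a symmetrized integral. -/
theorem tendsto_setIntegral_compl_ball {w : E → ℝ} (hw : ∀ y, w (-y) = w y) {r : ℝ} (hr : 0 < r)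
    (hint : ∀ ε, 0 < ε → IntegrableOn (fun y => g y * w y) (ball 0 ε)ᶜ)
    (hsym : IntegrableOn (fun y => (g y + g (-y)) * w y) (ball 0 r)) :
    Tendsto (fun ε : ℝ => ∫ y in (ball 0 ε)ᶜ, g y * w y) (𝓝[>] 0)
      (𝓝 ((∫ y in (ball 0 r)ᶜ, g y * w y) + 2⁻¹ * ∫ y in ball 0 r, (g y + g (-y)) * w y)) := by
  -- Absolute continuity of the integral: the symmetrized integrand is integrable up to the origin,
  -- and the volume of B_ε tends to 0.
  have h₀ : Tendsto (fun ε : ℝ => ∫ y in ball (0 : E) ε, (g y + g (-y)) * w y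
      ∂volume.restrict (ball 0 r)) (𝓝[>] 0) (𝓝 0) := by
    refine hsym.tendsto_setIntegral_nhds_zero ?_
    have h₁ : Tendsto (fun ε : ℝ => ENNReal.ofReal (ε ^ Module.finrank ℝ E) *
        (volume : Measure E) (ball 0 1)) (𝓝[>] 0) (𝓝 0) := by
      have h₂ : Tendsto (fun ε : ℝ => ENNReal.ofReal (ε ^ Module.finrank ℝ E)) (𝓝[>] 0)
          (𝓝 0) := by
        have : Continuous fun ε : ℝ => ENNReal.ofReal (ε ^ Module.finrank ℝ E) :=
          ENNReal.continuous_ofReal.comp (continuous_pow _)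
        simpa [zero_pow Module.finrank_pos.ne'] using
          (this.tendsto 0).mono_left nhdsWithin_le_nhds
      simpa using ENNReal.Tendsto.mul_const h₂ (Or.inr measure_ball_lt_top.ne)
    refine tendsto_of_tendsto_of_tendsto_of_le_of_le' tendsto_const_nhds h₁
      (Eventually.of_forall fun _ => zero_le) ?_
    filter_upwards [self_mem_nhdsWithin] with ε hε
    exact (Measure.restrict_apply_le _ _).trans (Measure.addHaar_ball volume 0 (le_of_lt hε)).le
  have h₁ := (h₀.const_sub (∫ y in ball (0 : E) r, (g y + g (-y)) * w y)).const_mul 2⁻¹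
  rw [sub_zero] at h₁
  refine (h₁.const_add (∫ y in (ball 0 r)ᶜ, g y * w y)).congr' ?_
  filter_upwards [Ioo_mem_nhdsGT hr] with ε hε
  have hsub : ball (0 : E) ε ⊆ ball 0 r := ball_subset_ball hε.2.le
  have hA : MeasurableSet (ball (0 : E) r \ ball 0 ε) := measurableSet_ball.diff measurableSet_ball
  have hsplit : (ball (0 : E) ε)ᶜ = (ball 0 r)ᶜ ∪ (ball 0 r \ ball 0 ε) := by
    ext y
    simp only [mem_compl_iff, mem_union, Set.mem_sdiff]
    have := @hsub y
    tauto
  have hIA : IntegrableOn (fun y => g y * w y) (ball (0 : E) r \ ball 0 ε) :=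
    (hint ε hε.1).mono_set fun y hy => hy.2
  -- On the symmetric annulus the original integrand is integrable, so its integral is half the
  -- symmetrized one.
  have h₃ := setIntegral_add_comp_neg hA (fun y => by simp) hIA
  simp only [hw, ← add_mul] at h₃
  rw [setIntegral_sdiff measurableSet_ball hsym hsub] at h₃
  rw [Measure.restrict_restrict measurableSet_ball, inter_eq_left.2 hsub, h₃, hsplit,
    setIntegral_union (disjoint_compl_left.mono_right sdiff_subset) hA (hint r hr) hIA]
  ring

end Averages

/-! ### Error estimates for the three expansions -/

section Expansion

variable {d : ℕ}

theorem continuous_leadingTerm {p : ℝ} (hp : 2 ≤ p) (φ : EuclideanSpace ℝ (Fin d) → ℝ)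
    (z : EuclideanSpace ℝ (Fin d)) : Continuous (leadingTerm p φ z) := by
  have h₁ : Continuous fun y => |fderiv ℝ φ z y| ^ (p - 2) :=
    Continuous.rpow_const (by fun_prop) fun _ => Or.inr (by linarith)
  have h₂ : Continuous fun y => iteratedFDeriv ℝ 2 φ z fun _ => y :=
    (iteratedFDeriv ℝ 2 φ z).cont.comp (by fun_prop)
  exact (continuous_const.mul h₁).mul h₂

theorem continuousOn_J_increment {p : ℝ} (hp : 2 ≤ p) {x z : EuclideanSpace ℝ (Fin d)} {R : ℝ}
    {φ : EuclideanSpace ℝ (Fin d) → ℝ} (hφ : ContinuousOn φ (ball x R))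
    (hz : z ∈ ball x (R / 2)) :
    ContinuousOn (fun y => J p (φ (z + y) - φ z)) (ball 0 (R / 2)) := by
  refine (continuous_J hp).comp_continuousOn (ContinuousOn.sub ?_ continuousOn_const)
  exact hφ.comp (by fun_prop) fun y hy =>
    add_mem_ball_of_mem_ball_half hz (mem_ball_zero_iff.1 hy)

theorem integrableOn_ball_of_continuousOn {g : EuclideanSpace ℝ (Fin d) → ℝ} {r r₀ : ℝ}
    (hg : ContinuousOn g (ball 0 r₀)) (hr : r < r₀) : IntegrableOn g (ball 0 r) :=
  ((hg.mono (closedBall_subset_ball hr)).integrableOn_compact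
    (isCompact_closedBall 0 r)).mono_set ball_subset_closedBall

theorem fracIntegrand_eq (s p : ℝ) (φ : EuclideanSpace ℝ (Fin d) → ℝ)
    (z : EuclideanSpace ℝ (Fin d)) : fracIntegrand s p φ z =
      fun y => J p (φ (z + y) - φ z) * ‖y‖ ^ (-((d : ℝ) + s * p)) := by
  funext y
  rw [fracIntegrand, Real.rpow_neg (norm_nonneg y), div_eq_mul_inv]

/-- The numerator is essentially bounded and the weight decays with exponent d + sp > d. -/
theorem integrableOn_fracIntegrand {s p : ℝ} (hp : 2 ≤ p) (hs : 0 < s)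
    {φ : EuclideanSpace ℝ (Fin d) → ℝ} (hφ : MemLp φ ⊤ volume) (z : EuclideanSpace ℝ (Fin d))
    {ε : ℝ} (hε : 0 < ε) : IntegrableOn (fracIntegrand s p φ z) (ball 0 ε)ᶜ := by
  have hφz : MemLp (fun y => φ (z + y) - φ z) ⊤ volume :=
    (hφ.comp_measurePreserving (measurePreserving_add_left volume z)).sub (memLp_top_const _)
  set K : ℝ := (eLpNormEssSup (fun y => φ (z + y) - φ z) volume).toReal
  have hK : ∀ᵐ y, |φ (z + y) - φ z| ≤ K := by
    have h₁ : eLpNormEssSup (fun y => φ (z + y) - φ z) volume ≠ ⊤ := by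
      rw [← eLpNorm_exponent_top]
      exact hφz.2.ne
    filter_upwards [ae_le_eLpNormEssSup (f := fun y => φ (z + y) - φ z) (μ := volume)] with y hy
    have h₂ := ENNReal.toReal_mono h₁ hy
    rwa [toReal_enorm] at h₂
  have hsp : 0 < s * p := by positivity
  have hw := integrableOn_compl_ball_norm_rpow (E := EuclideanSpace ℝ (Fin d))
    (m := (d : ℝ) + s * p) hε (by simpa using hsp)
  rw [fracIntegrand_eq]
  refine (hw.const_mul (K ^ (p - 1))).mono' ?_ ?_
  · exact ((continuous_J hp).comp_aestronglyMeasurable hφz.1).restrict.mul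
      (measurable_norm.pow_const _).aestronglyMeasurable
  · filter_upwards [ae_restrict_of_ae hK] with y hy
    rw [norm_mul, Real.norm_eq_abs, abs_J hp,
      Real.norm_of_nonneg (Real.rpow_nonneg (norm_nonneg y) _)]
    exact mul_le_mul_of_nonneg_right (Real.rpow_le_rpow (abs_nonneg _) hy (by linarith))
      (Real.rpow_nonneg (norm_nonneg y) _)

/-- The surface measure of the unit sphere. -/
def sphereArea (d : ℕ) : ℝ :=
  (volume : Measure (EuclideanSpace ℝ (Fin d))).toSphere.real univ

theorem sphereAverage_eq (r : ℝ) (f : EuclideanSpace ℝ (Fin d) → ℝ) :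
    sphereAverage r f = (sphereArea d)⁻¹ *
      ∫ ω : sphere (0 : EuclideanSpace ℝ (Fin d)) 1, f (r • (ω : EuclideanSpace ℝ (Fin d)))
        ∂(volume : Measure (EuclideanSpace ℝ (Fin d))).toSphere := by
  rw [sphereAverage, average_eq, smul_eq_mul, sphereArea]

variable [NeZero d]

theorem natCast_dim_pos : (0 : ℝ) < d := Nat.cast_pos.2 (NeZero.pos d)

theorem measureReal_ball_eq {r : ℝ} (hr : 0 < r) :
    (volume : Measure (EuclideanSpace ℝ (Fin d))).real (ball 0 r) = r ^ (d : ℝ) / d *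
      sphereArea d := by
  have h := setIntegral_ball_norm_rpow (E := EuclideanSpace ℝ (Fin d)) (m := 0) hr
    (by simpa using natCast_dim_pos)
  simp only [Real.rpow_zero, zero_add, finrank_euclideanSpace_fin, integral_const,
    measureReal_restrict_apply_univ, smul_eq_mul, mul_one] at h
  exact h

theorem sphereArea_pos : 0 < sphereArea d := by
  have h := measureReal_ball_eq (d := d) one_pos
  have h₁ : 0 < (volume : Measure (EuclideanSpace ℝ (Fin d))).real (ball 0 1) :=
    ENNReal.toReal_pos (measure_ball_pos _ _ one_pos).ne' measure_ball_lt_top.ne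
  rw [h] at h₁
  exact pos_of_mul_pos_right h₁ (by positivity)

theorem kappa_eq (p : ℝ) : kappa p d = 2 * (sphereArea d / sphereMass p d) := by
  rw [kappa, sphereAverage_eq, mul_inv, inv_inv, sphereMass, div_eq_mul_inv]
  simp [EuclideanSpace.inner_single_left]

variable {p : ℝ} {φ : EuclideanSpace ℝ (Fin d) → ℝ} {z : EuclideanSpace ℝ (Fin d)} {C r₀ r : ℝ}

/-- The factor 2 in κ undoes the halving due to symmetrization: up to sign the error is (2I - r^p N)
/ (`sphereMass p d` · r^p), with I the integral of the increment over directions. -/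
theorem abs_pLaplacian_sub_M₁_le (hp : 2 ≤ p) (hφ : ContDiffAt ℝ 2 φ z)
    (hg : ContinuousOn (fun y => J p (φ (z + y) - φ z)) (ball 0 r₀))
    (hgQ : ∀ y, ‖y‖ < r₀ →
      |J p (φ (z + y) - φ z) + J p (φ (z + -y) - φ z) - leadingTerm p φ z y| ≤
        C * ‖y‖ ^ (p + gammaExp p))
    (hr : 0 < r) (hr₀ : r < r₀) :
    |pLaplacian p φ z - M₁ p r φ z| ≤ C * sphereArea d / sphereMass p d * r ^ gammaExp p := by
  have h := abs_integral_sphere_sub_le hg (continuous_leadingTerm hp φ z)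
    (fun t ht y => leadingTerm_smul p φ z y ht) hgQ hr hr₀
  have hS := sphereArea_pos (d := d)
  have hM := sphereMass_pos (d := d) (by linarith : 0 < p)
  have hrp : 0 < r ^ p := Real.rpow_pos_of_pos hr p
  rw [M₁, pLaplacian_eq hp hφ, sphereAverage_eq, kappa_eq]
  rw [← sphereArea] at h
  set N := ∫ ω : sphere (0 : EuclideanSpace ℝ (Fin d)) 1, leadingTerm p φ z ω
    ∂(volume : Measure (EuclideanSpace ℝ (Fin d))).toSphere
  set I := ∫ ω : sphere (0 : EuclideanSpace ℝ (Fin d)) 1,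
    J p (φ (z + r • (ω : EuclideanSpace ℝ (Fin d))) - φ z)
    ∂(volume : Measure (EuclideanSpace ℝ (Fin d))).toSphere
  have e : (sphereMass p d)⁻¹ * N -
      2 * (sphereArea d / sphereMass p d) / r ^ p * ((sphereArea d)⁻¹ * I) =
      -((2 * I - r ^ p * N) / (sphereMass p d * r ^ p)) := by
    field_simp
    ring
  rw [e, abs_neg, abs_div, abs_of_pos (by positivity : 0 < sphereMass p d * r ^ p),
    div_le_iff₀ (by positivity)]
  refine h.trans (le_of_eq ?_)
  rw [Real.rpow_add hr]
  field_simp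

theorem abs_pLaplacian_sub_M₂_le (hp : 2 ≤ p) (hC : 0 ≤ C) (hφ : ContDiffAt ℝ 2 φ z)
    (hg : ContinuousOn (fun y => J p (φ (z + y) - φ z)) (ball 0 r₀))
    (hgQ : ∀ y, ‖y‖ < r₀ →
      |J p (φ (z + y) - φ z) + J p (φ (z + -y) - φ z) - leadingTerm p φ z y| ≤
        C * ‖y‖ ^ (p + gammaExp p))
    (hr : 0 < r) (hr₀ : r < r₀) :
    |pLaplacian p φ z - M₂ p r φ z| ≤ C * sphereArea d / sphereMass p d * r ^ gammaExp p := by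
  have hd := natCast_dim_pos (d := d)
  have hγ := gammaExp_pos p hp
  have h := (abs_setIntegral_ball_sub_le (k := 0) (by linarith : 0 < p) hγ.le hg
    (continuous_leadingTerm hp φ z)
    (fun t ht y => leadingTerm_smul p φ z y ht) hgQ hr hr₀
    (by rw [finrank_euclideanSpace_fin]; linarith)).2
  have hS := sphereArea_pos (d := d)
  have hM := sphereMass_pos (d := d) (by linarith : 0 < p)
  have hrp : 0 < r ^ p := Real.rpow_pos_of_pos hr p
  have hrd : 0 < r ^ (d : ℝ) := Real.rpow_pos_of_pos hr d
  have hrγ : 0 < r ^ gammaExp p := Real.rpow_pos_of_pos hr _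
  simp only [Real.rpow_zero, mul_one, add_zero, finrank_euclideanSpace_fin] at h
  rw [← sphereArea, setIntegral_add_comp_neg measurableSet_ball neg_mem_ball_zero_iff
    (integrableOn_ball_of_continuousOn hg hr₀), Real.rpow_add hr, Real.rpow_add hr, Real.rpow_add hr] at h
  rw [M₂, pLaplacian_eq hp hφ, setAverage_eq, measureReal_ball_eq hr, kappa_eq, smul_eq_mul]
  set N := ∫ ω : sphere (0 : EuclideanSpace ℝ (Fin d)) 1, leadingTerm p φ z ω
    ∂(volume : Measure (EuclideanSpace ℝ (Fin d))).toSphere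
  set I := ∫ y in ball 0 r, J p (φ (z + y) - φ z)
  have hpd : 0 < p + d := by linarith
  have e : (sphereMass p d)⁻¹ * N -
      (p + d) * (2 * (sphereArea d / sphereMass p d)) / (d * r ^ p) *
        ((r ^ (d : ℝ) / d * sphereArea d)⁻¹ * I) =
      -((2 * I - r ^ p * r ^ (d : ℝ) / (p + d) * N) * ((p + d) /
        (sphereMass p d * (r ^ p * r ^ (d : ℝ))))) := by
    field_simp
    ring
  rw [e, abs_neg, abs_mul, abs_of_pos (by positivity :
    0 < (p + d) / (sphereMass p d * (r ^ p * r ^ (d : ℝ))))]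
  refine (mul_le_mul_of_nonneg_right h (by positivity)).trans ?_
  -- Radial integration of the remainder gives a denominator larger than p + d, so the constant of
  -- the spherical case suffices.
  have hle : (p + d) / (p + gammaExp p + d) ≤ 1 := by
    rw [div_le_one (by linarith)]; linarith
  calc _ = C * sphereArea d / sphereMass p d * r ^ gammaExp p *
        ((p + d) / (p + gammaExp p + d)) := by
        have : p + gammaExp p + d ≠ 0 := by linarith
        field_simp
    _ ≤ _ := mul_le_of_le_one_right (by positivity) hle

/-- The ball estimate is used twice, with weight exponents -(d+sp) and 0. The resulting main terms
r^(p(1-s)) N / (2p(1-s)) cancel, and the two remainders contribute equal halves of the constant. -/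
theorem exists_hasFracPLaplacian {s : ℝ} (hs : s ∈ Ioo (0 : ℝ) 1) (hp : 2 ≤ p) (hC : 0 ≤ C)
    (hr₀ : 0 < r₀) (hφ : MemLp φ ⊤ volume)
    (hg : ContinuousOn (fun y => J p (φ (z + y) - φ z)) (ball 0 r₀))
    (hgQ : ∀ y, ‖y‖ < r₀ →
      |J p (φ (z + y) - φ z) + J p (φ (z + -y) - φ z) - leadingTerm p φ z y| ≤
        C * ‖y‖ ^ (p + gammaExp p)) :
    ∃ L : ℝ, HasFracPLaplacian s p φ z L ∧ ∀ r : ℝ, 0 < r → r < r₀ →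
      |L - Mfrac s p r φ z| ≤
        C * sphereArea d / (p * (1 - s)) * r ^ (gammaExp p + p * (1 - s)) := by
  have hd := natCast_dim_pos (d := d)
  have hγ := gammaExp_pos p hp
  have hS := sphereArea_pos (d := d)
  have hq : 0 < p * (1 - s) := mul_pos (by linarith) (by linarith [hs.2])
  have hcont := continuous_leadingTerm hp φ z
  have hhom : ∀ t : ℝ, 0 < t → ∀ y, leadingTerm p φ z (t • y) = t ^ p * leadingTerm p φ z y :=
    fun t ht y => leadingTerm_smul p φ z y ht
  have hk : p + -((d : ℝ) + s * p) + d = p * (1 - s) := by ring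
  have hkγ : p + gammaExp p + -((d : ℝ) + s * p) + d = gammaExp p + p * (1 - s) := by ring
  have hk' : 0 < p + -((d : ℝ) + s * p) + Module.finrank ℝ (EuclideanSpace ℝ (Fin d)) := by
    rw [finrank_euclideanSpace_fin, hk]; exact hq
  have hfrac : fracIntegrand s p φ z =
      fun y => J p (φ (z + y) - φ z) * ‖y‖ ^ (-((d : ℝ) + s * p)) :=
    fracIntegrand_eq s p φ z
  have hint := fun ε (hε : 0 < ε) => integrableOn_fracIntegrand hp hs.1 hφ z hε
  have hsing := fun r (hr : 0 < r) (hrr : r < r₀) => abs_setIntegral_ball_sub_le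
    (by linarith : 0 < p) hγ.le hg hcont hhom hgQ hr hrr hk'
  have hT := fun r (hr : 0 < r) (hrr : r < r₀) => tendsto_setIntegral_compl_ball
    (w := fun y : EuclideanSpace ℝ (Fin d) => ‖y‖ ^ (-((d : ℝ) + s * p)))
    (fun y => by rw [norm_neg]) hr (by rw [← hfrac]; exact hint) (hsing r hr hrr).1
  simp only [← hfrac] at hT
  -- The limit is produced at the radius r₀/2; uniqueness of limits then gives its representation at
  -- every r < r₀.
  obtain ⟨L, hL⟩ : ∃ L, Tendsto (fun ε : ℝ => ∫ y in (ball 0 ε)ᶜ, fracIntegrand s p φ z y)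
      (𝓝[>] 0) (𝓝 L) := ⟨_, hT (r₀ / 2) (by linarith) (by linarith)⟩
  refine ⟨L, ⟨hint, hL⟩, fun r hr hrr => ?_⟩
  have hdim : 0 < p + 0 + Module.finrank ℝ (EuclideanSpace ℝ (Fin d)) := by
    rw [finrank_euclideanSpace_fin]; linarith
  rw [tendsto_nhds_unique hL (hT r hr hrr), Mfrac]
  have h₁ := (hsing r hr hrr).2
  have h₂ := (abs_setIntegral_ball_sub_le (by linarith : 0 < p) hγ.le hg hcont hhom hgQ hr hrr
    hdim).2
  simp only [Real.rpow_zero, mul_one, add_zero, finrank_euclideanSpace_fin] at h₂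
  rw [finrank_euclideanSpace_fin, hk, hkγ, ← sphereArea, Real.rpow_add hr] at h₁
  rw [← sphereArea, setIntegral_add_comp_neg measurableSet_ball neg_mem_ball_zero_iff
    (integrableOn_ball_of_continuousOn hg hrr),
    -- This splitting isolates r^(d+sp), which cancels against the prefactor in `Mfrac`.
    show p + d = p * (1 - s) + (d + s * p) by ring,
    show p + gammaExp p + d = gammaExp p + (p * (1 - s) + (d + s * p)) by ring,
    Real.rpow_add hr (gammaExp p), Real.rpow_add hr (p * (1 - s))] at h₂
  rw [show p + d = p * (1 - s) + (d + s * p) by ring, Real.rpow_add hr (gammaExp p)]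
  have hm : 0 < (d : ℝ) + s * p := by
    have := mul_pos hs.1 (by linarith : 0 < p)
    linarith
  have hX : 0 < r ^ (p * (1 - s)) := Real.rpow_pos_of_pos hr _
  have hY : 0 < r ^ ((d : ℝ) + s * p) := Real.rpow_pos_of_pos hr _
  have hG : 0 < r ^ gammaExp p := Real.rpow_pos_of_pos hr _
  generalize p * (1 - s) = q at *
  generalize (d : ℝ) + s * p = m at *
  generalize r ^ q = X at *
  generalize r ^ m = Y at *
  generalize r ^ gammaExp p = G at *
  generalize gammaExp p = γ at *
  set N := ∫ ω : sphere (0 : EuclideanSpace ℝ (Fin d)) 1, leadingTerm p φ z ω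
    ∂(volume : Measure (EuclideanSpace ℝ (Fin d))).toSphere
  set I := ∫ y in ball 0 r, J p (φ (z + y) - φ z)
  set K := ∫ y in ball 0 r, (J p (φ (z + y) - φ z) + J p (φ (z + -y) - φ z)) * ‖y‖ ^ (-m)
  have e : (∫ y in (ball 0 r)ᶜ, fracIntegrand s p φ z y) + 2⁻¹ * K -
      ((q + m) / (q * Y) * I + ∫ y in (ball 0 r)ᶜ, fracIntegrand s p φ z y) =
      2⁻¹ * (K - X / q * N) - (q + m) / (2 * q * Y) * (2 * I - X * Y / (q + m) * N) := by
    field_simp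
    ring
  rw [e]
  refine (abs_sub _ _).trans ?_
  rw [abs_mul, abs_mul, abs_of_pos (by norm_num : (0 : ℝ) < 2⁻¹),
    abs_of_pos (by positivity : 0 < (q + m) / (2 * q * Y))]
  have hle : G * X / (γ + q) ≤ G * X / q :=
    div_le_div_of_nonneg_left (by positivity) hq (by linarith)
  have hle' : G * (X * Y) / (γ + (q + m)) ≤ G * (X * Y) / (q + m) :=
    div_le_div_of_nonneg_left (by positivity) (by positivity) (by linarith)
  calc 2⁻¹ * |K - X / q * N| + (q + m) / (2 * q * Y) * |2 * I - X * Y / (q + m) * N|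
      ≤ 2⁻¹ * (C * sphereArea d * (G * X / q)) +
        (q + m) / (2 * q * Y) * (C * sphereArea d * (G * (X * Y) / (q + m))) := by
        gcongr
        · exact h₁.trans (by gcongr)
        · exact h₂.trans (by gcongr)
    _ = C * sphereArea d / q * (G * X) := by
        field_simp
        ring

end Expansion

end PLap

end

/-! ### Conclusion, with constants uniform in z -/

theorem theorem2p1 {d : ℕ} [NeZero d] (p s : ℝ) (hp : 2 ≤ p) (hs : s ∈ Set.Ioo (0 : ℝ) 1)
    (x : EuclideanSpace ℝ (Fin d)) (R : ℝ) (hR₀ : 0 < R) (hR₁ : R < 1)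
    (φ : EuclideanSpace ℝ (Fin d) → ℝ) (hφ : PLap.MemCb 4 φ (Metric.ball x R)) :
    (∃ C : ℝ, 0 < C ∧ ∀ z ∈ Metric.ball x (R / 2),
      DifferentiableAt ℝ (PLap.flux p φ) z ∧
      ∀ r : ℝ, 0 < r → r < R / 2 →
        |PLap.pLaplacian p φ z - PLap.M₁ p r φ z| ≤ C * r ^ PLap.gammaExp p ∧
        |PLap.pLaplacian p φ z - PLap.M₂ p r φ z| ≤ C * r ^ PLap.gammaExp p) ∧
    (MeasureTheory.MemLp φ ⊤ MeasureTheory.volume →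
      ∃ C : ℝ, 0 < C ∧ ∀ z ∈ Metric.ball x (R / 2),
        ∃ L : ℝ, PLap.HasFracPLaplacian s p φ z L ∧
          ∀ r : ℝ, 0 < r → r < R / 2 →
            |L - PLap.Mfrac s p r φ z| ≤ C * r ^ (PLap.gammaExp p + p * (1 - s))) := by
  obtain ⟨C, hC, h⟩ := PLap.exists_abs_J_add_J_sub_leadingTerm_le hp hR₁ hφ
  have hsub : ball x (R / 2) ⊆ ball x R := ball_subset_ball (by linarith)
  have hS := PLap.sphereArea_pos (d := d)
  have hM := PLap.sphereMass_pos (d := d) (by linarith : 0 < p)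
  have hps : 0 < p * (1 - s) := mul_pos (by linarith) (by linarith [hs.2])
  have hφ₂ : ∀ z ∈ ball x (R / 2), ContDiffAt ℝ 2 φ z := fun z hz =>
    (hφ.1.contDiffAt (isOpen_ball.mem_nhds (hsub hz))).of_le (by norm_num)
  have hg := fun z hz => PLap.continuousOn_J_increment (z := z) hp hφ.1.continuousOn hz
  -- Adding 1 keeps the final constant strictly positive even when C = 0.
  have hle : ∀ c A t : ℝ, 0 < c → 0 < A → 0 < t →
      C * A / c * t ≤ (C * A / c + 1) * t := fun c A t _ _ ht => by nlinarith
  constructor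
  · refine ⟨C * PLap.sphereArea d / PLap.sphereMass p d + 1, by positivity, fun z hz =>
      ⟨(PLap.hasFDerivAt_flux hp (hφ₂ z hz)).differentiableAt, fun r hr hrR => ⟨?_, ?_⟩⟩⟩
    · exact (PLap.abs_pLaplacian_sub_M₁_le hp (hφ₂ z hz) (hg z hz) (h z hz) hr hrR).trans
        (hle _ _ _ hM hS (Real.rpow_pos_of_pos hr _))
    · exact (PLap.abs_pLaplacian_sub_M₂_le hp hC (hφ₂ z hz) (hg z hz) (h z hz) hr hrR).trans
        (hle _ _ _ hM hS (Real.rpow_pos_of_pos hr _))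
  · intro hφL
    refine ⟨C * PLap.sphereArea d / (p * (1 - s)) + 1, by positivity, fun z hz => ?_⟩
    obtain ⟨L, hL, hL'⟩ := PLap.exists_hasFracPLaplacian hs hp hC (by linarith : 0 < R / 2) hφL
      (hg z hz) (h z hz)
    exact ⟨L, hL, fun r hr hrR => (hL' r hr hrR).trans
      (hle _ _ _ hps hS (Real.rpow_pos_of_pos hr _))⟩
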